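/- Let $\mathcal S$ be an (abstract) operator system: a complex $*$-vector space with a matrix ordering $\{M_n(\mathcal S)^+\}_{n\ge 1}$ and an Archimedean matrix order unit $e$. Every unital C*-algebra $\mathcal A$ is regarded as an operator system via the positive cones of the C*-algebras $M_n(\mathcal A)$. Let $C^*_u(\mathcal S)$ be the universal C*-algebra of $\mathcal S$, that is, the completion of the free $*$-algebra on the vector space $\mathcal S$ with respect to the seminorm $\|u\|=\sup_\varphi\|\pi_\varphi(u)\|$, where $\varphi$ runs through the unital completely positive maps from $\mathcal S$ into C*-algebras and $\pi_\varphi(s_1\otimes\cdots\otimes s_n)=\varphi(s_1)\cdots\varphi(s_n)$; $\mathcal S$ is identified with its image in $C^*_u(\mathcal S)$. Let $J\subseteq\mathcal S$ be a kernel, that is, a subspace of the form $J=\ker\varphi$ for some unital completely positive map $\varphi$ from $\mathcal S$ into an operator system. Let $\mathcal S/J$ be the quotient operator system: its involution is $(x+J)^*=x^*+J$, its order unit is $e+J$, and $(x_{ij}+J)\in M_n(\mathcal S/J)$ is positive if and only if for every $\varepsilon>0$ there are $k_{ij}\in J$ with $\varepsilon\, e_n+(x_{ij}+k_{ij})\in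 M_n(\mathcal S)^+$, where $e_n$ is the diagonal $n\times n$ matrix with diagonal entries $e$. Let $\langle J\rangle$ be the closed two-sided ideal of $C^*_u(\mathcal S)$ generated by $J$. Then: 1. $J=\langle J\rangle\cap\mathcal S$. 2. The induced map $\mathcal S/J\to C^*_u(\mathcal S)/\langle J\rangle$, $x+J\mapsto x+\langle J\rangle$, is a complete order isomorphism onto its range; that is, it is injective and, for every $n$, a matrix in $M_n(\mathcal S/J)$ is positive if and only if its image in $M_n(C^*_u(\mathcal S)/\langle J\rangle)$ is positive. 3. There is a $*$-isomorphism $\pi: C^*_u(\mathcal S/J)\to C^*_u(\mathcal S)/\langle J\rangle$ with $\pi(x+J)=x+\langle J\rangle$ for all $x\in\mathcal S$. -/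

import Mathlib

open scoped Matrix

universe u v

/-- The matrix `A* X A`, where `A` is a scalar matrix and `X` a matrix with vector entries. -/
def Matrix.compress {V : Type u} [AddCommGroup V] [Module ℂ V] {n m : ℕ}
    (A : Matrix (Fin n) (Fin m) ℂ) (X : Matrix (Fin n) (Fin n) V) : Matrix (Fin m) (Fin m) V :=
  Matrix.of fun i j => ∑ k, ∑ l, (star (A k i) * A l j) • X k l

/-- An (abstract) operator system structure on a complex `*`-vector space `V`: a matrix ordering
`cone n ⊆ M_n(V)_h` together with an Archimedean matrix order unit `unit`. -/
class OperatorSystem (V : Type u) [AddCommGroup V] [Module ℂ V] [StarAddMonoid V]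
    [StarModule ℂ V] where
  unit : V
  star_unit : star unit = unit
  cone : ∀ n : ℕ, Set (Matrix (Fin n) (Fin n) V)
  conjTranspose_eq : ∀ {n : ℕ} {X : Matrix (Fin n) (Fin n) V}, X ∈ cone n → Xᴴ = X
  zero_mem : ∀ n : ℕ, 0 ∈ cone n
  add_mem : ∀ {n : ℕ} {X Y : Matrix (Fin n) (Fin n) V}, X ∈ cone n → Y ∈ cone n → X + Y ∈ cone n
  smul_mem : ∀ {n : ℕ} {X : Matrix (Fin n) (Fin n) V} {r : ℝ}, 0 ≤ r → X ∈ cone n →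
    (r : ℂ) • X ∈ cone n
  eq_zero : ∀ {n : ℕ} {X : Matrix (Fin n) (Fin n) V}, X ∈ cone n → -X ∈ cone n → X = 0
  compress_mem : ∀ {n m : ℕ} (A : Matrix (Fin n) (Fin m) ℂ) {X : Matrix (Fin n) (Fin n) V},
    X ∈ cone n → A.compress X ∈ cone m
  order_unit : ∀ {n : ℕ} {X : Matrix (Fin n) (Fin n) V}, Xᴴ = X →
    ∃ r : ℝ, 0 < r ∧ (r : ℂ) • Matrix.diagonal (fun _ => unit) - X ∈ cone n
  archimedean : ∀ {n : ℕ} {X : Matrix (Fin n) (Fin n) V},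
    (∀ r : ℝ, 0 < r → (r : ℂ) • Matrix.diagonal (fun _ => unit) + X ∈ cone n) → X ∈ cone n

namespace OperatorSystem

section Maps

variable {S : Type u} [AddCommGroup S] [Module ℂ S] [StarAddMonoid S] [StarModule ℂ S]
  [OperatorSystem S]
  {T : Type v} [AddCommGroup T] [Module ℂ T] [StarAddMonoid T] [StarModule ℂ T]
  [OperatorSystem T]

/-- Unital completely positive maps between operator systems. -/
structure IsUCP (φ : S →ₗ[ℂ] T) : Prop where
  map_unit : φ unit = unit
  map_cone : ∀ {n : ℕ} {X : Matrix (Fin n) (Fin n) S}, X ∈ cone n → X.map φ ∈ cone n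

/-- `φ` is a complete order isomorphism onto its range, the range having the matrix cones
`M_n(φ(S)) ∩ M_n(T)^+`: it is injective and a matrix over `S` is positive if and only if its image
is positive. -/
structure IsCompleteOrderEmbedding (φ : S →ₗ[ℂ] T) : Prop where
  injective : Function.Injective φ
  mem_cone_iff : ∀ {n : ℕ} {X : Matrix (Fin n) (Fin n) S}, X.map φ ∈ cone n ↔ X ∈ cone n

end Maps

/-! ### Unital C*-algebras as operator systems -/

section CStar

variable {A : Type u} [CStarAlgebra A]

/-- The positive elements of the C*-algebra `M_n(A)`. -/
def matrixPos (A : Type u) [CStarAlgebra A] (n : ℕ) : Set (Matrix (Fin n) (Fin n) A) :=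
  {X | ∃ Y : Matrix (Fin n) (Fin n) A, X = Yᴴ * Y}

section Abstract

variable {B : Type v} [CStarAlgebra B]

theorem star_mul_self_add (x y : B) : ∃ z, star x * x + star y * y = star z * z := by
  let _ := CStarAlgebra.spectralOrder B
  let _ := CStarAlgebra.spectralOrderedRing B
  exact CStarAlgebra.nonneg_iff_eq_star_mul_self.mp
    (add_nonneg (star_mul_self_nonneg x) (star_mul_self_nonneg y))

theorem star_mul_self_neg {x y : B} (h : -(star x * x) = star y * y) : star x * x = 0 := by
  let _ := CStarAlgebra.spectralOrder B
  let _ := CStarAlgebra.spectralOrderedRing B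
  exact le_antisymm (neg_nonneg.mp (h ▸ star_mul_self_nonneg y)) (star_mul_self_nonneg x)

theorem exists_smul_one_sub {x : B} (h : star x = x) :
    ∃ r : ℝ, 0 < r ∧ ∃ z : B, (r : ℂ) • 1 - x = star z * z := by
  let _ := CStarAlgebra.spectralOrder B
  let _ := CStarAlgebra.spectralOrderedRing B
  have h' : IsSelfAdjoint x := h
  refine ⟨‖x‖ + 1, by positivity, ?_⟩
  rw [← CStarAlgebra.nonneg_iff_eq_star_mul_self]
  have h1 := h'.le_algebraMap_norm_self
  have h2 : (((‖x‖ + 1 : ℝ) : ℂ) • (1 : B)) = algebraMap ℝ B ‖x‖ + 1 := by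
    rw [Complex.coe_smul, add_smul, one_smul, Algebra.algebraMap_eq_smul_one]
  rw [h2, sub_nonneg]
  exact h1.trans (le_add_of_nonneg_right zero_le_one)

theorem exists_of_archimedean {x : B}
    (h : ∀ r : ℝ, 0 < r → ∃ z : B, (r : ℂ) • 1 + x = star z * z) : ∃ z : B, x = star z * z := by
  let _ := CStarAlgebra.spectralOrder B
  let _ := CStarAlgebra.spectralOrderedRing B
  simp only [← CStarAlgebra.nonneg_iff_eq_star_mul_self] at *
  have hc : Filter.Tendsto (fun r : ℝ => (r : ℂ) • (1 : B) + x) (nhdsWithin 0 (Set.Ioi 0))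
      (nhds x) := by
    have : Continuous (fun r : ℝ => (r : ℂ) • (1 : B) + x) := by fun_prop
    simpa using (this.tendsto 0).mono_left nhdsWithin_le_nhds
  exact CStarAlgebra.isClosed_nonneg.mem_of_tendsto hc
    (Filter.eventually_of_mem self_mem_nhdsWithin fun r hr => h r hr)

end Abstract

theorem matrixPos_add {n : ℕ} {X Y : Matrix (Fin n) (Fin n) A} (hX : X ∈ matrixPos A n)
    (hY : Y ∈ matrixPos A n) : X + Y ∈ matrixPos A n := by
  let _ := CStarAlgebra.spectralOrder A
  let _ := CStarAlgebra.spectralOrderedRing A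
  obtain ⟨P, rfl⟩ := hX
  obtain ⟨Q, rfl⟩ := hY
  exact star_mul_self_add (B := CStarMatrix (Fin n) (Fin n) A) P Q

theorem zero_mem_matrixPos (n : ℕ) : (0 : Matrix (Fin n) (Fin n) A) ∈ matrixPos A n :=
  ⟨0, by simp⟩

theorem matrixPos_sum {ι : Type*} (s : Finset ι) {n : ℕ} {X : ι → Matrix (Fin n) (Fin n) A}
    (hX : ∀ i, X i ∈ matrixPos A n) : ∑ i ∈ s, X i ∈ matrixPos A n := by
  classical
  induction s using Finset.induction_on with
  | empty => simpa using zero_mem_matrixPos n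
  | insert a s ha ih => rw [Finset.sum_insert ha]; exact matrixPos_add (hX a) ih

theorem rectangular_mem_matrixPos {n m : ℕ} (Y : Matrix (Fin n) (Fin m) A) :
    Yᴴ * Y ∈ matrixPos A m := by
  rcases m with _ | m
  · exact ⟨0, Subsingleton.elim _ _⟩
  have : Yᴴ * Y = ∑ k, (Matrix.of fun i j => if i = 0 then Y k j else 0)ᴴ *
      (Matrix.of fun i j => if i = (0 : Fin (m + 1)) then Y k j else 0) := by
    ext i j
    rw [Matrix.sum_apply]
    simp [Matrix.mul_apply]
  rw [this]
  exact matrixPos_sum _ fun k => ⟨_, rfl⟩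

/-- A unital C*-algebra `A` as an operator system, with the positive cones of `M_n(A)`. -/
noncomputable instance ofCStarAlgebra : OperatorSystem A where
  unit := 1
  star_unit := star_one A
  cone := matrixPos A
  conjTranspose_eq := by rintro n _ ⟨Y, rfl⟩; simp
  zero_mem := zero_mem_matrixPos
  add_mem := matrixPos_add
  smul_mem := by
    rintro n _ r hr ⟨Y, rfl⟩
    refine ⟨((Real.sqrt r : ℝ) : ℂ) • Y, ?_⟩
    rw [Matrix.conjTranspose_smul, Matrix.smul_mul, Matrix.mul_smul, smul_smul]
    congr 1
    simp [← Complex.ofReal_mul, Real.mul_self_sqrt hr]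
  eq_zero := by
    rintro n _ ⟨P, rfl⟩ ⟨Q, hQ⟩
    let _ := CStarAlgebra.spectralOrder A
    let _ := CStarAlgebra.spectralOrderedRing A
    exact star_mul_self_neg (B := CStarMatrix (Fin n) (Fin n) A) hQ
  compress_mem := by
    rintro n m B _ ⟨Y, rfl⟩
    have : B.compress (Yᴴ * Y) =
        (Y * B.map (algebraMap ℂ A))ᴴ * (Y * B.map (algebraMap ℂ A)) := by
      ext i j
      simp only [Matrix.compress, Matrix.mul_apply, Matrix.of_apply, Matrix.conjTranspose_apply,
        Matrix.map_apply, star_sum, star_mul, Finset.sum_mul, Finset.mul_sum, Finset.smul_sum,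
        ← algebraMap_star_comm]
      simp only [← Algebra.commutes, ← Algebra.smul_def, mul_smul_comm, smul_mul_assoc, smul_smul]
      rw [Finset.sum_comm]
      conv_rhs => rw [Finset.sum_comm]
      refine Finset.sum_congr rfl fun l _ => ?_
      rw [Finset.sum_comm]
      refine Finset.sum_congr rfl fun x _ => Finset.sum_congr rfl fun k _ => ?_
      rw [mul_comm]
    rw [this]
    exact rectangular_mem_matrixPos _
  order_unit := by
    intro n X hX
    let _ := CStarAlgebra.spectralOrder A
    let _ := CStarAlgebra.spectralOrderedRing A
    obtain ⟨r, hr, z, hz⟩ := exists_smul_one_sub (B := CStarMatrix (Fin n) (Fin n) A) (x := X) hX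
    exact ⟨r, hr, z, hz⟩
  archimedean := by
    intro n X hX
    let _ := CStarAlgebra.spectralOrder A
    let _ := CStarAlgebra.spectralOrderedRing A
    exact exists_of_archimedean (B := CStarMatrix (Fin n) (Fin n) A) (x := X) hX

end CStar

/-! ### Kernels and quotient operator systems -/

section Quotient

theorem selfAdjoint_decomp {S : Type u} [AddCommGroup S] [Module ℂ S] [StarAddMonoid S]
    [StarModule ℂ S] (x : S) :
    ∃ a b : S, star a = a ∧ star b = b ∧ x = a + Complex.I • b := by
  refine ⟨(1 / 2 : ℂ) • (x + star x), (-Complex.I / 2) • (x - star x), ?_, ?_, ?_⟩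
  · simp [add_comm]
  · rw [star_smul, star_sub, star_star, ← neg_sub x (star x), smul_neg, ← neg_smul]
    congr 1
    simp [neg_div]
  · rw [smul_smul, show Complex.I * (-Complex.I / 2) = 1 / 2 by
      rw [mul_div_assoc', mul_neg, Complex.I_mul_I, neg_neg], ← smul_add]
    rw [show x + star x + (x - star x) = (2 : ℂ) • x by rw [two_smul]; abel, smul_smul]
    simp

variable {S : Type u} [AddCommGroup S] [Module ℂ S] [StarAddMonoid S] [StarModule ℂ S]
  [OperatorSystem S]

/-- A subspace of an operator system is a kernel if it is the kernel of some unital completely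
positive map into an operator system. -/
def IsKernel (J : Submodule ℂ S) : Prop :=
  ∃ (T : Type u) (_ : AddCommGroup T) (_ : Module ℂ T) (_ : StarAddMonoid T) (_ : StarModule ℂ T)
    (_ : OperatorSystem T) (φ : S →ₗ[ℂ] T), IsUCP φ ∧ LinearMap.ker φ = J

theorem diagonal_unit_mem (n : ℕ) :
    (Matrix.diagonal fun _ => unit : Matrix (Fin n) (Fin n) S) ∈ cone n := by
  obtain ⟨r, hr, h⟩ := order_unit (V := S) (n := n) (X := 0) (by simp)
  have := smul_mem (r := r⁻¹) (by positivity) h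
  rwa [sub_zero, smul_smul, ← Complex.ofReal_mul, inv_mul_cancel₀ hr.ne', Complex.ofReal_one,
    one_smul] at this

theorem smul_unit_mem (n : ℕ) {r : ℝ} (hr : 0 ≤ r) :
    (r : ℂ) • (Matrix.diagonal fun _ => unit : Matrix (Fin n) (Fin n) S) ∈ cone n :=
  smul_mem hr (diagonal_unit_mem n)

theorem map_smul_unit {T : Type v} [AddCommGroup T] [Module ℂ T] (φ : S →ₗ[ℂ] T) (n : ℕ)
    (c : ℂ) : (c • (Matrix.diagonal fun _ => unit : Matrix (Fin n) (Fin n) S)).map φ =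
      c • Matrix.diagonal fun _ => φ unit := by
  ext i j
  rcases eq_or_ne i j with rfl | h <;> simp [*]

section Hermitian

variable {T : Type v} [AddCommGroup T] [Module ℂ T] [StarAddMonoid T] [StarModule ℂ T]
  [OperatorSystem T]

theorem IsUCP.star_of_selfAdjoint {φ : S →ₗ[ℂ] T} (hφ : IsUCP φ) {x : S} (hx : star x = x) :
    star (φ x) = φ x := by
  obtain ⟨r, -, h⟩ := order_unit (V := S) (n := 1) (X := Matrix.of fun _ _ => x)
    (by ext i j; simpa using hx)
  have h2 := conjTranspose_eq (hφ.map_cone h)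
  have h3 := congrFun (congrFun h2 0) 0
  simp [hφ.map_unit, star_unit] at h3
  exact h3

theorem IsUCP.map_star {φ : S →ₗ[ℂ] T} (hφ : IsUCP φ) (x : S) : φ (star x) = star (φ x) := by
  obtain ⟨a, b, ha, hb, rfl⟩ := selfAdjoint_decomp x
  simp [ha, hb, hφ.star_of_selfAdjoint ha, hφ.star_of_selfAdjoint hb]

end Hermitian

theorem IsKernel.star_mem {J : Submodule ℂ S} (hJ : IsKernel J) {x : S} (hx : x ∈ J) :
    star x ∈ J := by
  obtain ⟨T, _, _, _, _, _, φ, hφ, rfl⟩ := hJ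
  rw [LinearMap.mem_ker] at *
  rw [hφ.map_star, hx, star_zero]

/-- The quotient of an operator system by a kernel. -/
def QuotientSystem (J : Submodule ℂ S) (_ : IsKernel J) : Type u := S ⧸ J

namespace QuotientSystem

variable (J : Submodule ℂ S) (hJ : IsKernel J)

instance : AddCommGroup (QuotientSystem J hJ) := inferInstanceAs (AddCommGroup (S ⧸ J))
instance : Module ℂ (QuotientSystem J hJ) := inferInstanceAs (Module ℂ (S ⧸ J))

/-- The quotient map `x ↦ x + J`. -/
def mk : S →ₗ[ℂ] QuotientSystem J hJ := J.mkQ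

theorem mk_surjective : Function.Surjective (mk J hJ) := J.mkQ_surjective

theorem mk_eq_zero {x : S} : mk J hJ x = 0 ↔ x ∈ J := Submodule.Quotient.mk_eq_zero J

/-- The involution `(x + J)* = x* + J`. -/
def starMap : QuotientSystem J hJ →ₗ⋆[ℂ] QuotientSystem J hJ :=
  J.mapQ J (starLinearEquiv ℂ : S ≃ₗ⋆[ℂ] S).toLinearMap fun _ hx => hJ.star_mem hx

instance : Star (QuotientSystem J hJ) := ⟨starMap J hJ⟩

theorem star_mk (x : S) : star (mk J hJ x) = mk J hJ (star x) := rfl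

instance : StarAddMonoid (QuotientSystem J hJ) where
  star_involutive x := by
    obtain ⟨x, rfl⟩ := mk_surjective J hJ x
    rw [star_mk, star_mk, star_star]
  star_add := (starMap J hJ).map_add

instance : StarModule ℂ (QuotientSystem J hJ) where
  star_smul := (starMap J hJ).map_smulₛₗ

/-- The matrix cones of the quotient: a matrix over `S / J` is positive if for every `ε > 0` it has
a representative `x` with `ε e_n + x ∈ M_n(S)^+`. -/
def quotientCone (n : ℕ) : Set (Matrix (Fin n) (Fin n) (QuotientSystem J hJ)) :=
  {X | ∀ ε : ℝ, 0 < ε → ∃ x : Matrix (Fin n) (Fin n) S, x.map (mk J hJ) = X ∧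
    (ε : ℂ) • Matrix.diagonal (fun _ => unit) + x ∈ cone n}

theorem exists_lift {n : ℕ} (X : Matrix (Fin n) (Fin n) (QuotientSystem J hJ)) :
    ∃ x : Matrix (Fin n) (Fin n) S, x.map (mk J hJ) = X := by
  choose f hf using fun i j => mk_surjective J hJ (X i j)
  exact ⟨Matrix.of f, by ext i j; simp [hf]⟩

theorem eq_zero_of_mem {n : ℕ} {X : Matrix (Fin n) (Fin n) (QuotientSystem J hJ)}
    (h1 : X ∈ quotientCone J hJ n) (h2 : -X ∈ quotientCone J hJ n) : X = 0 := by
  obtain ⟨T, _, _, _, _, _, φ, hφ, hker⟩ := id hJ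
  obtain ⟨x, rfl⟩ := exists_lift J hJ X
  have key : ∀ y : Matrix (Fin n) (Fin n) S, y.map (mk J hJ) ∈ quotientCone J hJ n →
      y.map φ ∈ cone n := by
    intro y hy
    refine archimedean fun r hr => ?_
    obtain ⟨z, hz, hz'⟩ := hy r hr
    have h3 := hφ.map_cone hz'
    rw [Matrix.map_add _ φ.map_add, map_smul_unit, hφ.map_unit] at h3
    convert h3 using 2
    ext i j
    have h4 := congrFun (congrFun hz i) j
    simp only [Matrix.map_apply] at h4 ⊢
    rw [← sub_eq_zero, ← map_sub, ← LinearMap.mem_ker, hker, ← mk_eq_zero J hJ, map_sub, h4,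
      sub_self]
  have h3 := eq_zero (key x h1) (by
    have := key (-x) (by convert h2; ext; simp)
    convert this; ext; simp)
  ext i j
  have h4 := congrFun (congrFun h3 i) j
  simp only [Matrix.map_apply, Matrix.zero_apply] at h4 ⊢
  rw [mk_eq_zero, ← hker]
  exact h4

/-- The quotient operator system `S / J`. -/
instance : OperatorSystem (QuotientSystem J hJ) where
  unit := mk J hJ unit
  star_unit := by rw [star_mk, star_unit]
  cone := quotientCone J hJ
  conjTranspose_eq := by
    intro n X hX
    obtain ⟨x, rfl, hx⟩ := hX 1 one_pos
    have h1 := conjTranspose_eq hx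
    have h2 := conjTranspose_eq (smul_unit_mem (S := S) n zero_le_one)
    rw [Matrix.conjTranspose_add, h2] at h1
    have h3 := add_left_cancel h1
    ext i j
    have h4 := congrFun (congrFun h3 i) j
    simp only [Matrix.conjTranspose_apply, Matrix.map_apply, star_mk] at h4 ⊢
    rw [h4]
  zero_mem n ε hε := ⟨0, by ext; simp, by rw [add_zero]; exact smul_unit_mem n hε.le⟩
  add_mem := by
    intro n X Y hX hY ε hε
    obtain ⟨x, rfl, hx⟩ := hX (ε / 2) (half_pos hε)
    obtain ⟨y, rfl, hy⟩ := hY (ε / 2) (half_pos hε)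
    refine ⟨x + y, by ext; simp, ?_⟩
    convert add_mem hx hy using 1
    rw [add_add_add_comm, ← add_smul, ← Complex.ofReal_add, add_halves]
  smul_mem := by
    intro n X r hr hX ε hε
    rcases hr.eq_or_lt with rfl | hr
    · exact ⟨0, by ext; simp, by rw [add_zero]; exact smul_unit_mem n hε.le⟩
    obtain ⟨x, rfl, hx⟩ := hX (ε / r) (by positivity)
    refine ⟨(r : ℂ) • x, by ext; simp, ?_⟩
    convert smul_mem hr.le hx using 1
    rw [smul_add, smul_smul, ← Complex.ofReal_mul, mul_div_cancel₀ _ hr.ne']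
  eq_zero := eq_zero_of_mem J hJ
  compress_mem := by
    intro n m A X hX ε hε
    have hadd : ∀ Y Z : Matrix (Fin n) (Fin n) S,
        A.compress (Y + Z) = A.compress Y + A.compress Z := by
      intro Y Z; ext i j; simp [Matrix.compress, Finset.sum_add_distrib]
    have hsmul : ∀ (c : ℂ) (Z : Matrix (Fin n) (Fin n) S),
        A.compress (c • Z) = c • A.compress Z := by
      intro c Z; ext i j; simp [Matrix.compress, Finset.smul_sum, smul_comm c]
    obtain ⟨r, hr, h⟩ := order_unit
      (conjTranspose_eq (compress_mem A (diagonal_unit_mem (S := S) n)))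
    obtain ⟨x, rfl, hx⟩ := hX (ε / r) (by positivity)
    refine ⟨A.compress x, by ext i j; simp [Matrix.compress], ?_⟩
    convert add_mem (smul_mem (r := ε / r) (by positivity) h) (compress_mem A hx) using 1
    rw [hadd, hsmul, smul_sub, smul_smul, ← Complex.ofReal_mul, div_mul_cancel₀ _ hr.ne']
    abel
  order_unit := by
    intro n X hX
    obtain ⟨y, rfl⟩ := exists_lift J hJ X
    obtain ⟨r, hr, h⟩ := order_unit (X := (1 / 2 : ℂ) • (y + yᴴ))
      (by rw [Matrix.conjTranspose_smul, Matrix.conjTranspose_add,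
            Matrix.conjTranspose_conjTranspose, add_comm]; simp)
    refine ⟨r, hr, fun ε hε => ⟨(r : ℂ) • Matrix.diagonal (fun _ => unit) -
      (1 / 2 : ℂ) • (y + yᴴ), ?_, add_mem (smul_unit_mem n hε.le) h⟩⟩
    rw [Matrix.map_sub _ (map_sub (mk J hJ)), map_smul_unit]
    congr 1
    ext i j
    have h1 := congrFun (congrFun hX i) j
    simp only [Matrix.conjTranspose_apply, Matrix.map_apply, star_mk] at h1
    simp only [Matrix.map_apply, Matrix.smul_apply, Matrix.add_apply, Matrix.conjTranspose_apply,
      map_smul, map_add, h1]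
    rw [← two_smul ℂ, smul_smul]
    simp
  archimedean := by
    intro n X hX ε hε
    obtain ⟨y, hy, h⟩ := hX (ε / 2) (half_pos hε) (ε / 2) (half_pos hε)
    refine ⟨y - ((ε / 2 : ℝ) : ℂ) • Matrix.diagonal (fun _ => unit), ?_, ?_⟩
    · rw [Matrix.map_sub _ (map_sub (mk J hJ)), map_smul_unit, hy]
      abel
    · convert h using 1
      have h2 : ((ε : ℝ) : ℂ) = ((ε / 2 : ℝ) : ℂ) + ((ε / 2 : ℝ) : ℂ) := by
        rw [← Complex.ofReal_add, add_halves]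
      rw [h2, add_smul]
      abel

end QuotientSystem

end Quotient

/-! ### Quotients of C*-algebras by closed two-sided ideals -/

section CStarQuotient

variable {A : Type u} [CStarAlgebra A]

/-- A closed two-sided self-adjoint ideal of a C*-algebra. -/
class IsCStarIdeal (I : Ideal A) : Prop where
  isTwoSided : I.IsTwoSided
  isClosed : IsClosed (I : Set A)
  star_mem : ∀ {x : A}, x ∈ I → star x ∈ I

attribute [instance] IsCStarIdeal.isTwoSided IsCStarIdeal.isClosed

namespace IsCStarIdeal

variable (I : Ideal A) [IsCStarIdeal I]

/-- The ideal as a `*`-subalgebra. -/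
def toStarSubalgebra : NonUnitalStarSubalgebra ℂ A where
  carrier := I
  add_mem' := I.add_mem
  zero_mem' := I.zero_mem
  mul_mem' _ hb := I.mul_mem_left _ hb
  smul_mem' c x hx := by
    rw [Algebra.smul_def]
    exact I.mul_mem_left _ hx
  star_mem' := IsCStarIdeal.star_mem

/-- Elements of the ideal are approximated by multiplying with elements of the ideal that lie
between `0` and `1`. -/
theorem exists_approx {i : A} (hi : i ∈ I) {ε : ℝ} (hε : 0 < ε) :
    ∃ e ∈ I, star e = e ∧ ‖1 - e‖ ≤ 1 ∧ ‖i * (1 - e)‖ < ε := by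
  have hcl : IsClosed (toStarSubalgebra I : Set A) := IsCStarIdeal.isClosed (I := I)
  let _ := CStarAlgebra.spectralOrder A
  let _ := CStarAlgebra.spectralOrderedRing A
  let B := toStarSubalgebra I
  let _ : NonUnitalCStarAlgebra B := NonUnitalStarSubalgebra.nonUnitalCStarAlgebra B
  let _ : PartialOrder B := CStarAlgebra.spectralOrder B
  have : StarOrderedRing B := CStarAlgebra.spectralOrderedRing B
  have h := CStarAlgebra.increasingApproximateUnit B
  have h1 := h.tendsto_mul_left (⟨i, hi⟩ : B)
  have h2 := (Metric.tendsto_nhds.mp h1 ε hε).and (h.eventually_nonneg.and h.eventually_norm)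
  have := h.neBot
  obtain ⟨e, he1, he2, he3⟩ := h2.exists
  obtain ⟨b, hb⟩ := CStarAlgebra.nonneg_iff_eq_star_mul_self.mp he2
  have hb' : (e : A) = star (b : A) * b := congrArg Subtype.val hb
  have he0 : (0 : A) ≤ e := hb' ▸ star_mul_self_nonneg _
  have he4 : (e : A) ∈ Set.Icc (0 : A) 1 := CStarAlgebra.mem_Icc_iff_norm_le_one.mpr ⟨he0, he3⟩
  refine ⟨e, e.2, he0.isSelfAdjoint.star_eq, ?_, ?_⟩
  · refine (CStarAlgebra.mem_Icc_iff_norm_le_one.mp ⟨sub_nonneg.mpr he4.2, ?_⟩).2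
    simpa using he0
  · rw [dist_comm, dist_eq_norm] at he1
    rw [mul_sub, mul_one]
    exact he1

theorem star_sub_mem {x y : A} (h : x - y ∈ I) : star x - star y ∈ I := by
  rw [← star_sub]
  exact star_mem h

instance : StarRing (A ⧸ I) where
  star := Quotient.map' star fun a b h => by
    rw [Submodule.quotientRel_def] at *
    exact star_sub_mem I h
  star_involutive := by
    rintro ⟨a⟩
    exact congrArg (Ideal.Quotient.mk I) (star_star a)
  star_mul := by
    rintro ⟨a⟩ ⟨b⟩
    exact congrArg (Ideal.Quotient.mk I) (star_mul a b)
  star_add := by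
    rintro ⟨a⟩ ⟨b⟩
    exact congrArg (Ideal.Quotient.mk I) (star_add a b)

theorem mk_star (a : A) : Ideal.Quotient.mk I (star a) = star (Ideal.Quotient.mk I a) := rfl

theorem norm_sq_le (a : A) :
    ‖Ideal.Quotient.mk I a‖ * ‖Ideal.Quotient.mk I a‖ ≤ ‖Ideal.Quotient.mk I (star a * a)‖ := by
  refine le_of_forall_pos_le_add fun ε hε => ?_
  obtain ⟨c, hc, hc'⟩ := Submodule.Quotient.norm_mk_lt (S := I)
    (Ideal.Quotient.mk I (star a * a)) (half_pos hε)
  have hi : c - star a * a ∈ I := (Submodule.Quotient.eq I).mp hc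
  obtain ⟨e, heI, hes, he1, he2⟩ := exists_approx I hi (half_pos hε)
  have hs : star (1 - e) = 1 - e := by rw [star_sub, star_one, hes]
  have h1 : ‖Ideal.Quotient.mk I a‖ ≤ ‖a * (1 - e)‖ := by
    have : Ideal.Quotient.mk I a = Ideal.Quotient.mk I (a * (1 - e)) := by
      rw [Ideal.Quotient.eq, mul_sub, mul_one, sub_sub_cancel]
      exact I.mul_mem_left _ heI
    rw [this]
    exact Submodule.Quotient.norm_mk_le I _
  calc ‖Ideal.Quotient.mk I a‖ * ‖Ideal.Quotient.mk I a‖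
      ≤ ‖a * (1 - e)‖ * ‖a * (1 - e)‖ := by gcongr
    _ = ‖(1 - e) * c * (1 - e) - (1 - e) * ((c - star a * a) * (1 - e))‖ := by
        rw [← CStarRing.norm_star_mul_self, star_mul, hs]
        congr 1
        noncomm_ring
    _ ≤ ‖(1 - e) * c * (1 - e)‖ + ‖(1 - e) * ((c - star a * a) * (1 - e))‖ := norm_sub_le _ _
    _ ≤ 1 * ‖c‖ * 1 + 1 * (ε / 2) := by
        gcongr
        · exact (norm_mul_le _ _).trans (by gcongr; exact (norm_mul_le _ _).trans (by gcongr))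
        · exact (norm_mul_le _ _).trans (by gcongr)
    _ ≤ ‖Ideal.Quotient.mk I (star a * a)‖ + ε := by linarith

/-- The C*-algebra structure on `A / I`, with the quotient norm. -/
noncomputable instance : CStarAlgebra (A ⧸ I) where
  __ := Submodule.Quotient.normedAddCommGroup I
  __ := Ideal.Quotient.ring I
  __ := (inferInstance : StarRing (A ⧸ I))
  __ := (inferInstance : CompleteSpace (A ⧸ I))
  __ := (Ideal.Quotient.algebra ℂ : Algebra ℂ (A ⧸ I))
  norm_mul_le x y := by
    have hlim : Filter.Tendsto (fun δ : ℝ => (‖x‖ + δ) * (‖y‖ + δ)) (nhdsWithin 0 (Set.Ioi 0))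
        (nhds (‖x‖ * ‖y‖)) := by
      have : Continuous fun δ : ℝ => (‖x‖ + δ) * (‖y‖ + δ) := by fun_prop
      simpa using (this.tendsto 0).mono_left nhdsWithin_le_nhds
    refine ge_of_tendsto hlim (Filter.eventually_of_mem self_mem_nhdsWithin fun δ hδ => ?_)
    obtain ⟨a, rfl, ha⟩ := Submodule.Quotient.norm_mk_lt x hδ
    obtain ⟨b, rfl, hb⟩ := Submodule.Quotient.norm_mk_lt y hδ
    exact (Submodule.Quotient.norm_mk_le I (a * b)).trans
      ((norm_mul_le a b).trans (mul_le_mul ha.le hb.le (norm_nonneg _)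
        ((norm_nonneg a).trans ha.le)))
  norm_mul_self_le := by
    rintro ⟨a⟩
    exact norm_sq_le I a
  norm_smul_le c x := norm_smul_le c x
  star_smul := by
    rintro c ⟨a⟩
    exact congrArg (Ideal.Quotient.mk I) (star_smul c a)

end IsCStarIdeal

/-- The quotient C*-algebra `A / I`. -/
def CStarQuotient (I : Ideal A) : Type u := A ⧸ I

namespace CStarQuotient

variable (I : Ideal A) [IsCStarIdeal I]

noncomputable instance : CStarAlgebra (CStarQuotient I) := inferInstanceAs (CStarAlgebra (A ⧸ I))

/-- The quotient map `a ↦ a + I`. -/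
def mk : A →⋆ₐ[ℂ] CStarQuotient I where
  toFun a := Ideal.Quotient.mk I a
  map_one' := rfl
  map_mul' _ _ := rfl
  map_zero' := rfl
  map_add' _ _ := rfl
  commutes' _ := rfl
  map_star' _ := rfl

theorem mk_surjective : Function.Surjective (mk I) := Ideal.Quotient.mk_surjective

theorem mk_eq_zero {a : A} : mk I a = 0 ↔ a ∈ I := Ideal.Quotient.eq_zero_iff_mem

theorem norm_mk (a : A) : ‖mk I a‖ = Metric.infDist a (I : Set A) :=
  QuotientAddGroup.norm_mk (S := I.toAddSubgroup) ..

end CStarQuotient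

end CStarQuotient

/-! ### The universal C*-algebra -/

section Universal

section Free

variable (S : Type u) [AddCommGroup S] [Module ℂ S]

/-- The tensor algebra `ℂ ⊕ S ⊕ (S ⊗ S) ⊕ ⋯` of `S`, to be equipped with the involution
`(s₁ ⊗ ⋯ ⊗ sₙ)* = sₙ* ⊗ ⋯ ⊗ s₁*`. -/
def FreeStarAlgebra : Type u := TensorAlgebra ℂ S

noncomputable instance : Ring (FreeStarAlgebra S) := inferInstanceAs (Ring (TensorAlgebra ℂ S))
noncomputable instance : Algebra ℂ (FreeStarAlgebra S) :=
  inferInstanceAs (Algebra ℂ (TensorAlgebra ℂ S))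

end Free

namespace FreeStarAlgebra

section Basic

variable (S : Type u) [AddCommGroup S] [Module ℂ S]

/-- The inclusion of `S` as the tensors of degree one. -/
noncomputable def gen : S →ₗ[ℂ] FreeStarAlgebra S := TensorAlgebra.ι ℂ

variable {S}

/-- The homomorphism `π_φ (s₁ ⊗ ⋯ ⊗ sₙ) = φ(s₁) ⋯ φ(sₙ)`. -/
noncomputable def lift {B : Type v} [Ring B] [Algebra ℂ B] (φ : S →ₗ[ℂ] B) :
    FreeStarAlgebra S →ₐ[ℂ] B := TensorAlgebra.lift ℂ φ

@[simp]
theorem lift_gen {B : Type v} [Ring B] [Algebra ℂ B] (φ : S →ₗ[ℂ] B) (s : S) :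
    lift φ (gen S s) = φ s := TensorAlgebra.lift_ι_apply φ s

theorem hom_ext {B : Type v} [Ring B] [Algebra ℂ B] {f g : FreeStarAlgebra S →ₐ[ℂ] B}
    (h : ∀ s, f (gen S s) = g (gen S s)) : f = g :=
  TensorAlgebra.hom_ext (LinearMap.ext h)

theorem induction {C : FreeStarAlgebra S → Prop} (h1 : ∀ r, C (algebraMap ℂ _ r))
    (h2 : ∀ s, C (gen S s)) (h3 : ∀ a b, C a → C b → C (a * b))
    (h4 : ∀ a b, C a → C b → C (a + b)) (a : FreeStarAlgebra S) : C a :=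
  TensorAlgebra.induction (C := C) h1 h2 h3 h4 a

end Basic

section Star

/-- The opposite algebra with conjugated scalar multiplication. -/
def ConjOpposite (B : Type v) : Type v := Bᵐᵒᵖ

instance (B : Type v) [Ring B] : Ring (ConjOpposite B) := inferInstanceAs (Ring Bᵐᵒᵖ)

noncomputable instance (B : Type v) [Ring B] [Algebra ℂ B] : Algebra ℂ (ConjOpposite B) :=
  ((algebraMap ℂ Bᵐᵒᵖ).comp (starRingEnd ℂ)).toAlgebra' fun c x =>
    Algebra.commutes (A := Bᵐᵒᵖ) (starRingEnd ℂ c) x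

/-- The identity map into the opposite algebra. -/
def ConjOpposite.op {B : Type v} (x : B) : ConjOpposite B := MulOpposite.op x

/-- The identity map from the opposite algebra. -/
def ConjOpposite.unop {B : Type v} (x : ConjOpposite B) : B := MulOpposite.unop x

theorem ConjOpposite.smul_op {B : Type v} [Ring B] [Algebra ℂ B] (c : ℂ) (x : B) :
    c • ConjOpposite.op x = ConjOpposite.op (star c • x) := by
  rw [Algebra.smul_def (star c), Algebra.commutes]
  rfl

theorem ConjOpposite.unop_algebraMap {B : Type v} [Ring B] [Algebra ℂ B] (c : ℂ) :
    ConjOpposite.unop (algebraMap ℂ (ConjOpposite B) c) = algebraMap ℂ B (star c) := rfl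

variable {S : Type u} [AddCommGroup S] [Module ℂ S] [StarAddMonoid S] [StarModule ℂ S]

/-- The involution as a homomorphism into the conjugate opposite algebra. -/
noncomputable def starHom : FreeStarAlgebra S →ₐ[ℂ] ConjOpposite (FreeStarAlgebra S) :=
  lift
    { toFun := fun s => ConjOpposite.op (gen S (star s))
      map_add' := fun s t => by rw [star_add, map_add]; rfl
      map_smul' := fun c s => by
        rw [star_smul, map_smul, RingHom.id_apply]
        exact (ConjOpposite.smul_op c (gen S (star s))).symm }

noncomputable instance : Star (FreeStarAlgebra S) := ⟨fun x => ConjOpposite.unop (starHom x)⟩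

theorem star_gen (s : S) : star (gen S s) = gen S (star s) :=
  congrArg ConjOpposite.unop (lift_gen _ s)

theorem star_algebraMap (c : ℂ) : star (algebraMap ℂ (FreeStarAlgebra S) c) =
    algebraMap ℂ (FreeStarAlgebra S) (star c) :=
  congrArg ConjOpposite.unop ((starHom (S := S)).commutes c)

theorem star_mul' (a b : FreeStarAlgebra S) : star (a * b) = star b * star a :=
  congrArg ConjOpposite.unop (map_mul starHom a b)

theorem star_add' (a b : FreeStarAlgebra S) : star (a + b) = star a + star b :=
  congrArg ConjOpposite.unop (map_add starHom a b)

noncomputable instance : StarRing (FreeStarAlgebra S) where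
  star_involutive := by
    refine induction (fun c => ?_) (fun s => ?_) (fun a b ha hb => ?_) (fun a b ha hb => ?_)
    · rw [star_algebraMap, star_algebraMap, star_star]
    · rw [star_gen, star_gen, star_star]
    · rw [star_mul', star_mul', ha, hb]
    · rw [star_add', star_add', ha, hb]
  star_mul := star_mul'
  star_add := star_add'

instance : StarModule ℂ (FreeStarAlgebra S) where
  star_smul c x := by
    rw [Algebra.smul_def, star_mul, star_algebraMap, ← Algebra.commutes, ← Algebra.smul_def]

end Star

section Norm

variable {S : Type u} [AddCommGroup S] [Module ℂ S] [StarAddMonoid S] [StarModule ℂ S]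
  [OperatorSystem S]

theorem lift_star {B : Type v} [CStarAlgebra B] {φ : S →ₗ[ℂ] B} (hφ : IsUCP φ)
    (x : FreeStarAlgebra S) : lift φ (star x) = star (lift φ x) := by
  refine induction (C := fun x => lift φ (star x) = star (lift φ x))
    (fun c => ?_) (fun s => ?_) (fun a b ha hb => ?_) (fun a b ha hb => ?_) x
  · rw [star_algebraMap, AlgHom.commutes, AlgHom.commutes, algebraMap_star_comm]
  · rw [star_gen, lift_gen, lift_gen, hφ.map_star]
  · rw [star_mul, map_mul, map_mul, star_mul, ha, hb]
  · rw [star_add, map_add, map_add, star_add, ha, hb]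

/-- The values `‖π_φ(x)‖`, where `φ` runs through the unital completely positive maps from `S` into
C*-algebras (equivalently, into algebras `B(H)`, as every C*-algebra embeds in one of these). -/
def normValues (x : FreeStarAlgebra S) : Set ℝ :=
  {r | ∃ (B : Type u) (_ : CStarAlgebra B) (φ : S →ₗ[ℂ] B), IsUCP φ ∧ r = ‖lift φ x‖}

theorem norm_le_of_pos {B : Type v} [CStarAlgebra B] {b x y : B} {r : ℝ} (hr : 0 ≤ r)
    (h1 : (r : ℂ) • 1 - b = star x * x) (h2 : (r : ℂ) • 1 + b = star y * y) : ‖b‖ ≤ 3 * r := by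
  let _ := CStarAlgebra.spectralOrder B
  let _ := CStarAlgebra.spectralOrderedRing B
  have h3 : 0 ≤ (r : ℂ) • 1 - b := h1 ▸ star_mul_self_nonneg x
  have h4 : 0 ≤ (r : ℂ) • 1 + b := h2 ▸ star_mul_self_nonneg y
  have h5 : (r : ℂ) • (1 : B) = algebraMap ℝ B r := by
    rw [Complex.coe_smul, Algebra.algebraMap_eq_smul_one]
  have h6 : ‖(r : ℂ) • (1 : B) + b‖ ≤ 2 * r := by
    rw [CStarAlgebra.norm_le_iff_le_algebraMap _ (by positivity) h4, two_mul, map_add, ← h5]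
    exact add_le_add_right (sub_nonneg.mp h3) _
  have h7 : ‖(r : ℂ) • (1 : B)‖ ≤ r := by
    have h8 : (0 : B) ≤ (r : ℂ) • (1 : B) := by
      rw [Complex.coe_smul]
      exact smul_nonneg hr zero_le_one
    rw [CStarAlgebra.norm_le_iff_le_algebraMap _ hr h8, h5]
  calc ‖b‖ = ‖((r : ℂ) • (1 : B) + b) - (r : ℂ) • (1 : B)‖ := by rw [add_sub_cancel_left]
    _ ≤ 2 * r + r := (norm_sub_le _ _).trans (add_le_add h6 h7)
    _ = 3 * r := by ring

theorem exists_of_mem_matrixPos_one {B : Type v} [CStarAlgebra B]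
    {X : Matrix (Fin 1) (Fin 1) B} (hX : X ∈ matrixPos B 1) : ∃ b, X 0 0 = star b * b := by
  obtain ⟨Y, rfl⟩ := hX
  exact ⟨Y 0 0, by simp [Matrix.mul_apply]⟩

theorem exists_bound_gen (s : S) : ∃ C : ℝ, ∀ (B : Type u) (_ : CStarAlgebra B) (φ : S →ₗ[ℂ] B),
    IsUCP φ → ‖φ s‖ ≤ C := by
  have key : ∀ s : S, star s = s → ∃ C : ℝ, ∀ (B : Type u) (_ : CStarAlgebra B) (φ : S →ₗ[ℂ] B),
      IsUCP φ → ‖φ s‖ ≤ C := by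
    intro s hs
    obtain ⟨r, hr, h⟩ := order_unit (V := S) (n := 1) (X := Matrix.of fun _ _ => s)
      (by ext i j; simpa using hs)
    obtain ⟨t, ht, h'⟩ := order_unit (V := S) (n := 1) (X := -Matrix.of fun _ _ => s)
      (by ext i j; simpa using hs)
    have h1 := add_mem h (smul_unit_mem (S := S) 1 ht.le)
    have h2 := add_mem h' (smul_unit_mem (S := S) 1 hr.le)
    refine ⟨3 * (r + t), fun B _ φ hφ => ?_⟩
    obtain ⟨x, hx⟩ := exists_of_mem_matrixPos_one (hφ.map_cone h1)
    obtain ⟨y, hy⟩ := exists_of_mem_matrixPos_one (hφ.map_cone h2)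
    have h1 : φ unit = 1 := hφ.map_unit
    refine norm_le_of_pos (x := x) (y := y) (by positivity) ?_ ?_
    · rw [← hx]
      simp [h1, add_smul]
      abel
    · rw [← hy]
      simp [h1, add_smul]
      abel
  obtain ⟨a, b, ha, hb, rfl⟩ := selfAdjoint_decomp s
  obtain ⟨C, hC⟩ := key a ha
  obtain ⟨D, hD⟩ := key b hb
  refine ⟨C + D, fun B _ φ hφ => ?_⟩
  rw [map_add, map_smul]
  refine (norm_add_le _ _).trans (add_le_add (hC B _ φ hφ) ?_)
  rw [norm_smul, Complex.norm_I, one_mul]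
  exact hD B _ φ hφ

theorem exists_bound (x : FreeStarAlgebra S) : ∃ C : ℝ, ∀ (B : Type u) (_ : CStarAlgebra B)
    (φ : S →ₗ[ℂ] B), IsUCP φ → ‖lift φ x‖ ≤ C := by
  refine induction (C := fun x => ∃ C : ℝ, ∀ (B : Type u) (_ : CStarAlgebra B)
    (φ : S →ₗ[ℂ] B), IsUCP φ → ‖lift φ x‖ ≤ C)
    (fun c => ?_) (fun s => ?_) (fun a b ha hb => ?_) (fun a b ha hb => ?_) x
  · refine ⟨‖c‖, fun B _ φ hφ => ?_⟩
    rw [AlgHom.commutes]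
    rcases subsingleton_or_nontrivial B with h | h
    · rw [Subsingleton.elim (algebraMap ℂ B c) 0, norm_zero]
      exact norm_nonneg c
    · rw [norm_algebraMap']
  · obtain ⟨C, hC⟩ := exists_bound_gen s
    exact ⟨C, fun B _ φ hφ => by rw [lift_gen]; exact hC B _ φ hφ⟩
  · obtain ⟨C, hC⟩ := ha
    obtain ⟨D, hD⟩ := hb
    refine ⟨C * D, fun B _ φ hφ => ?_⟩
    rw [map_mul]
    exact (norm_mul_le _ _).trans (mul_le_mul (hC B _ φ hφ) (hD B _ φ hφ) (norm_nonneg _)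
      ((norm_nonneg _).trans (hC B _ φ hφ)))
  · obtain ⟨C, hC⟩ := ha
    obtain ⟨D, hD⟩ := hb
    refine ⟨C + D, fun B _ φ hφ => ?_⟩
    rw [map_add]
    exact (norm_add_le _ _).trans (add_le_add (hC B _ φ hφ) (hD B _ φ hφ))

theorem bddAbove_normValues (x : FreeStarAlgebra S) : BddAbove (normValues x) := by
  obtain ⟨C, hC⟩ := exists_bound x
  exact ⟨C, by rintro _ ⟨B, _, φ, hφ, rfl⟩; exact hC B _ φ hφ⟩

/-- The seminorm `‖x‖ = sup_φ ‖π_φ(x)‖`. -/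
noncomputable instance : Norm (FreeStarAlgebra S) := ⟨fun x => sSup (normValues x)⟩

theorem norm_def (x : FreeStarAlgebra S) : ‖x‖ = sSup (normValues x) := rfl

theorem norm_lift_le {B : Type u} [CStarAlgebra B] {φ : S →ₗ[ℂ] B} (hφ : IsUCP φ)
    (x : FreeStarAlgebra S) : ‖lift φ x‖ ≤ ‖x‖ :=
  le_csSup (bddAbove_normValues x) ⟨B, _, φ, hφ, rfl⟩

protected theorem norm_nonneg (x : FreeStarAlgebra S) : 0 ≤ ‖x‖ :=
  Real.sSup_nonneg (by rintro _ ⟨B, _, φ, -, rfl⟩; exact norm_nonneg _)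

protected theorem norm_le {x : FreeStarAlgebra S} {C : ℝ} (hC : 0 ≤ C)
    (h : ∀ (B : Type u) (_ : CStarAlgebra B) (φ : S →ₗ[ℂ] B), IsUCP φ → ‖lift φ x‖ ≤ C) :
    ‖x‖ ≤ C :=
  Real.sSup_le (by rintro _ ⟨B, _, φ, hφ, rfl⟩; exact h B _ φ hφ) hC

protected theorem norm_add_le (x y : FreeStarAlgebra S) : ‖x + y‖ ≤ ‖x‖ + ‖y‖ :=
  FreeStarAlgebra.norm_le
    (add_nonneg (FreeStarAlgebra.norm_nonneg x) (FreeStarAlgebra.norm_nonneg y))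
    fun B _ φ hφ => by
      rw [map_add]
      exact (norm_add_le _ _).trans (add_le_add (norm_lift_le hφ x) (norm_lift_le hφ y))

protected theorem norm_mul_le (x y : FreeStarAlgebra S) : ‖x * y‖ ≤ ‖x‖ * ‖y‖ :=
  FreeStarAlgebra.norm_le
    (mul_nonneg (FreeStarAlgebra.norm_nonneg x) (FreeStarAlgebra.norm_nonneg y))
    fun B _ φ hφ => by
      rw [map_mul]
      exact (norm_mul_le _ _).trans (mul_le_mul (norm_lift_le hφ x) (norm_lift_le hφ y)
        (norm_nonneg _) (FreeStarAlgebra.norm_nonneg x))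

protected theorem norm_smul_le (c : ℂ) (x : FreeStarAlgebra S) : ‖c • x‖ ≤ ‖c‖ * ‖x‖ :=
  FreeStarAlgebra.norm_le (mul_nonneg (norm_nonneg c) (FreeStarAlgebra.norm_nonneg x))
    fun B _ φ hφ => by
      rw [map_smul, norm_smul]
      exact mul_le_mul_of_nonneg_left (norm_lift_le hφ x) (norm_nonneg c)

protected theorem norm_star_le (x : FreeStarAlgebra S) : ‖star x‖ ≤ ‖x‖ :=
  FreeStarAlgebra.norm_le (FreeStarAlgebra.norm_nonneg x) fun B _ φ hφ => by
    rw [lift_star hφ, norm_star]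
    exact norm_lift_le hφ x

protected theorem norm_mul_self_le (x : FreeStarAlgebra S) : ‖x‖ * ‖x‖ ≤ ‖star x * x‖ := by
  have h : ‖x‖ ≤ √‖star x * x‖ := FreeStarAlgebra.norm_le (Real.sqrt_nonneg _) fun B _ φ hφ => by
    refine Real.le_sqrt_of_sq_le ?_
    rw [sq, ← CStarRing.norm_star_mul_self, ← lift_star hφ, ← map_mul]
    exact norm_lift_le hφ _
  have h2 := mul_self_le_mul_self (FreeStarAlgebra.norm_nonneg x) h
  rwa [Real.mul_self_sqrt (FreeStarAlgebra.norm_nonneg _)] at h2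

noncomputable instance : SeminormedRing (FreeStarAlgebra S) where
  __ := (inferInstance : Ring (FreeStarAlgebra S))
  __ := SeminormedAddCommGroup.ofCore (𝕜 := ℂ) (E := FreeStarAlgebra S)
    { norm_nonneg := FreeStarAlgebra.norm_nonneg
      norm_smul := fun c x => by
        refine le_antisymm (FreeStarAlgebra.norm_smul_le c x) ?_
        rcases eq_or_ne c 0 with rfl | hc
        · rw [norm_zero, zero_mul]
          exact FreeStarAlgebra.norm_nonneg _
        · have h := FreeStarAlgebra.norm_smul_le c⁻¹ (c • x)
          rw [smul_smul, inv_mul_cancel₀ hc, one_smul, norm_inv] at h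
          rwa [← div_eq_inv_mul, le_div_iff₀ (norm_pos_iff.mpr hc), mul_comm] at h
      norm_triangle := FreeStarAlgebra.norm_add_le }
  norm_mul_le := FreeStarAlgebra.norm_mul_le

noncomputable instance : NormedAlgebra ℂ (FreeStarAlgebra S) where
  norm_smul_le := FreeStarAlgebra.norm_smul_le

instance : NormedStarGroup (FreeStarAlgebra S) where
  norm_star_le := FreeStarAlgebra.norm_star_le

end Norm

end FreeStarAlgebra

/-- The universal C*-algebra `C*_u(S)`: the completion of the free `*`-algebra of `S` in the
seminorm `sup_φ ‖π_φ(·)‖` (elements of seminorm zero being identified with zero). -/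
def UniversalCStar (S : Type u) [AddCommGroup S] [Module ℂ S] [StarAddMonoid S] [StarModule ℂ S]
    [OperatorSystem S] : Type u :=
  UniformSpace.Completion (FreeStarAlgebra S)

namespace UniversalCStar

variable (S : Type u) [AddCommGroup S] [Module ℂ S] [StarAddMonoid S] [StarModule ℂ S]
  [OperatorSystem S]

open UniformSpace

noncomputable instance : NormedRing (UniversalCStar S) :=
  inferInstanceAs (NormedRing (Completion (FreeStarAlgebra S)))

instance : CompleteSpace (UniversalCStar S) :=
  inferInstanceAs (CompleteSpace (Completion (FreeStarAlgebra S)))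

noncomputable instance : Algebra ℂ (UniversalCStar S) :=
  inferInstanceAs (Algebra ℂ (Completion (FreeStarAlgebra S)))

/-- The canonical homomorphism from the free `*`-algebra. -/
noncomputable def ofFree : FreeStarAlgebra S →ₐ[ℂ] UniversalCStar S where
  toRingHom := (Completion.coeRingHom : FreeStarAlgebra S →+* Completion (FreeStarAlgebra S))
  commutes' _ := rfl

theorem norm_ofFree (x : FreeStarAlgebra S) : ‖ofFree S x‖ = ‖x‖ := Completion.norm_coe x

theorem denseRange_ofFree : DenseRange (ofFree S) := Completion.denseRange_coe

variable {S} in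
theorem induction_on {p : UniversalCStar S → Prop} (hp : IsClosed {a | p a})
    (h : ∀ x, p (ofFree S x)) (a : UniversalCStar S) : p a :=
  Completion.induction_on a hp h

noncomputable instance : Star (UniversalCStar S) :=
  ⟨(Completion.map star : Completion (FreeStarAlgebra S) → Completion (FreeStarAlgebra S))⟩

theorem star_ofFree (x : FreeStarAlgebra S) : star (ofFree S x) = ofFree S (star x) :=
  Completion.map_coe (NormedAddGroupHom.uniformContinuous
    (starNormedAddGroupHom : NormedAddGroupHom (FreeStarAlgebra S) (FreeStarAlgebra S))) x

theorem continuous_star' : Continuous (star : UniversalCStar S → UniversalCStar S) :=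
  Completion.continuous_map

noncomputable instance : StarRing (UniversalCStar S) where
  star_involutive := by
    have := continuous_star' S
    refine induction_on (isClosed_eq (by fun_prop) (by fun_prop)) fun x => ?_
    rw [star_ofFree, star_ofFree, star_star]
  star_mul := by
    have := continuous_star' S
    intro a b
    refine induction_on (p := fun a => star (a * b) = star b * star a)
      (isClosed_eq (by fun_prop) (by fun_prop)) (fun x => ?_) a
    refine induction_on (p := fun b => star (ofFree S x * b) = star b * star (ofFree S x))
      (isClosed_eq (by fun_prop) (by fun_prop)) (fun y => ?_) b
    rw [← map_mul, star_ofFree, star_ofFree, star_ofFree, star_mul, map_mul]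
  star_add := by
    have := continuous_star' S
    intro a b
    refine induction_on (p := fun a => star (a + b) = star a + star b)
      (isClosed_eq (by fun_prop) (by fun_prop)) (fun x => ?_) a
    refine induction_on (p := fun b => star (ofFree S x + b) = star (ofFree S x) + star b)
      (isClosed_eq (by fun_prop) (by fun_prop)) (fun y => ?_) b
    rw [← map_add, star_ofFree, star_ofFree, star_ofFree, star_add, map_add]

noncomputable instance : NormedAlgebra ℂ (UniversalCStar S) where
  norm_smul_le c a := by
    have hc : Continuous fun a : UniversalCStar S => c • a := by
      simp only [Algebra.smul_def]
      fun_prop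
    refine induction_on (p := fun a => ‖c • a‖ ≤ ‖c‖ * ‖a‖)
      (isClosed_le hc.norm (continuous_const.mul continuous_norm)) (fun x => ?_) a
    have h : c • ofFree S x = ofFree S (c • x) := (map_smul (ofFree S) c x).symm
    rw [h, norm_ofFree, norm_ofFree]
    exact norm_smul_le c x

noncomputable instance : CStarAlgebra (UniversalCStar S) where
  norm_mul_self_le a := by
    have := continuous_star' S
    refine induction_on (p := fun a => ‖a‖ * ‖a‖ ≤ ‖star a * a‖)
      (isClosed_le (by fun_prop) (by fun_prop)) (fun x => ?_) a
    rw [star_ofFree, ← map_mul, norm_ofFree, norm_ofFree]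
    exact FreeStarAlgebra.norm_mul_self_le x
  star_smul c a := by
    have := continuous_star' S
    have hc : ∀ c : ℂ, Continuous fun a : UniversalCStar S => c • a := fun c => by
      simp only [Algebra.smul_def]
      fun_prop
    refine induction_on (p := fun a => star (c • a) = star c • star a)
      (isClosed_eq (this.comp (hc c)) ((hc (star c)).comp this)) (fun x => ?_) a
    have h : ∀ (c : ℂ) (x : FreeStarAlgebra S), c • ofFree S x = ofFree S (c • x) :=
      fun c x => (map_smul (ofFree S) c x).symm
    rw [h, star_ofFree, star_ofFree, star_smul, h]

/-- The canonical map `S → C*_u(S)`. -/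
noncomputable def ι : S →ₗ[ℂ] UniversalCStar S :=
  (ofFree S).toLinearMap ∘ₗ FreeStarAlgebra.gen S

theorem star_ι (s : S) : star (ι S s) = ι S (star s) :=
  (star_ofFree S _).trans (congrArg (ofFree S) (FreeStarAlgebra.star_gen s))

end UniversalCStar

end Universal

/-! ### The ideal generated by a kernel -/

section Ideal

/-- The closed two-sided ideal of a C*-algebra generated by a set. -/
noncomputable def closedIdealSpan {A : Type u} [CStarAlgebra A] (s : Set A) : Ideal A :=
  (TwoSidedIdeal.span s).asIdeal.closure

theorem subset_closedIdealSpan {A : Type u} [CStarAlgebra A] (s : Set A) :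
    s ⊆ closedIdealSpan s :=
  fun _ hx => subset_closure (TwoSidedIdeal.subset_span hx)

theorem isCStarIdeal_closedIdealSpan {A : Type u} [CStarAlgebra A] {s : Set A}
    (hs : ∀ x ∈ s, star x ∈ s) : IsCStarIdeal (closedIdealSpan s) where
  isTwoSided := ⟨fun {a} b ha => map_mem_closure (f := fun x => x * b) (by fun_prop) ha
    fun x hx => (TwoSidedIdeal.span s).mul_mem_right x b hx⟩
  isClosed := isClosed_closure
  star_mem {x} hx := by
    refine map_mem_closure continuous_star hx fun y hy => ?_
    refine TwoSidedIdeal.span_induction (p := fun y _ => star y ∈ TwoSidedIdeal.span s)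
      (fun y hy => TwoSidedIdeal.subset_span (hs y hy)) ?_ (fun a b _ _ ha hb => ?_)
      (fun a _ ha => ?_) (fun a b _ hb => ?_) (fun a b _ hb => ?_) hy
    · rw [star_zero]; exact (TwoSidedIdeal.span s).zero_mem
    · rw [star_add]; exact (TwoSidedIdeal.span s).add_mem ha hb
    · rw [star_neg]; exact (TwoSidedIdeal.span s).neg_mem ha
    · rw [star_mul]; exact TwoSidedIdeal.mul_mem_right _ _ _ hb
    · rw [star_mul]; exact TwoSidedIdeal.mul_mem_left _ _ _ hb

variable {S : Type u} [AddCommGroup S] [Module ℂ S] [StarAddMonoid S] [StarModule ℂ S]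
  [OperatorSystem S] (J : Submodule ℂ S) (hJ : IsKernel J)

/-- The closed two-sided ideal `⟨J⟩` of `C*_u(S)` generated by `J`. -/
noncomputable def idealGen (J : Submodule ℂ S) (_ : IsKernel J) : Ideal (UniversalCStar S) :=
  closedIdealSpan (UniversalCStar.ι S '' J)

instance : IsCStarIdeal (idealGen J hJ) :=
  isCStarIdeal_closedIdealSpan (by
    rintro _ ⟨x, hx, rfl⟩
    exact ⟨star x, hJ.star_mem hx, (UniversalCStar.star_ι S x).symm⟩)

/-- The map `S / J → C*_u(S) / ⟨J⟩`, `x + J ↦ x + ⟨J⟩`, induced by the inclusion of `S`. -/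
noncomputable def inducedMap : QuotientSystem J hJ →ₗ[ℂ] CStarQuotient (idealGen J hJ) :=
  J.liftQ ((CStarQuotient.mk (idealGen J hJ)).toLinearMap ∘ₗ UniversalCStar.ι S) fun x hx =>
    (CStarQuotient.mk_eq_zero _).mpr (subset_closedIdealSpan _ ⟨x, hx, rfl⟩)

theorem inducedMap_mk (x : S) : inducedMap J hJ (QuotientSystem.mk J hJ x) =
    CStarQuotient.mk (idealGen J hJ) (UniversalCStar.ι S x) := rfl

end Ideal

end OperatorSystem

/-! ### Testing positivity in C*-algebras by homomorphisms. -/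

namespace OperatorSystem

/-! The two C*-algebras are compared by a pair of *-homomorphisms. The composite `S → S/J →
C*_u(S/J)` is unital completely positive, so it extends to `C*_u(S)`; it kills `J`, hence `⟨J⟩`, and
gives `quotientToUniversal`. Conversely the induced map of `S/J` into `C*_u(S)/⟨J⟩` is unital
completely positive and extends to `universalToQuotient`. The two are inverse on generators, hence
everywhere. Moreover `quotientToUniversal` after the induced map is the canonical map of `S/J` into
its universal algebra. If the latter is a complete order embedding, so is the induced map, and its
injectivity is the assertion `J = ⟨J⟩ ∩ S`. That `J` is a kernel enters through `S/J` being an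
operator system, to which the embedding theorem applies.

What remains is that every operator system `T` embeds in `C*_u(T)`. The canonical map is completely
positive (`isUCP_ι`) because the lifts of completely positive maps separate points, and a hermitian
element is positive once a separating family maps it to positive elements (`map_negPart_eq_zero`).
It reflects positivity because a hermitian matrix `X` outside the cone stays non-positive under some
unital completely positive map (`exists_isUCP_notMem`). To find that map, the M. Riesz extension
theorem yields a positive functional `f` with `f X < 0`. The map `t ↦ (f (E_ij ⊗ t))` into scalar
matrices has amplifications whose quadratic forms are values of `f` at compressions
(`blockForm_matrixMap`), so it is completely positive and sends `X` to a non-positive matrix. A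
small perturbation makes its value at the unit invertible, and a conjugation makes it unital. -/

theorem map_mem_matrixPos {A : Type u} {B : Type v} [CStarAlgebra A] [CStarAlgebra B]
    (π : A →⋆ₐ[ℂ] B) {n : ℕ} {X : Matrix (Fin n) (Fin n) A} (hX : X ∈ matrixPos A n) :
    X.map π ∈ matrixPos B n := by
  obtain ⟨Y, rfl⟩ := hX
  exact ⟨Y.map π, by ext i j; simp [Matrix.mul_apply, map_star]⟩

theorem isUCP_starAlgHom {A : Type u} {B : Type v} [CStarAlgebra A] [CStarAlgebra B]
    (π : A →⋆ₐ[ℂ] B) : IsUCP (π : A →ₐ[ℂ] B).toLinearMap where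
  map_unit := map_one π
  map_cone hX := map_mem_matrixPos π hX

theorem IsUCP.comp {R : Type*} [AddCommGroup R] [Module ℂ R] [StarAddMonoid R] [StarModule ℂ R]
    [OperatorSystem R] {S : Type*} [AddCommGroup S] [Module ℂ S] [StarAddMonoid S]
    [StarModule ℂ S] [OperatorSystem S] {T : Type*} [AddCommGroup T] [Module ℂ T]
    [StarAddMonoid T] [StarModule ℂ T] [OperatorSystem T] {ψ : S →ₗ[ℂ] T} {φ : R →ₗ[ℂ] S}
    (hψ : IsUCP ψ) (hφ : IsUCP φ) : IsUCP (ψ ∘ₗ φ) where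
  map_unit := (congrArg ψ hφ.map_unit).trans hψ.map_unit
  map_cone hX := hψ.map_cone (hφ.map_cone hX)

/-- A homomorphism that maps a self-adjoint element to a positive one kills its negative part. -/
theorem map_negPart_eq_zero {A : Type u} {B : Type v} [CStarAlgebra A] [CStarAlgebra B]
    [PartialOrder A] [StarOrderedRing A] [PartialOrder B] [StarOrderedRing B]
    (π : A →⋆ₙₐ[ℂ] B) {a : A} (ha : IsSelfAdjoint a) (h : 0 ≤ π a) : π a⁻ = 0 := by
  set q := π a⁻ with hq
  have hq0 : 0 ≤ q := by
    obtain ⟨y, hy⟩ := CStarAlgebra.nonneg_iff_eq_star_mul_self.mp (CFC.negPart_nonneg a)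
    rw [hq, hy, map_mul, map_star]
    exact star_mul_self_nonneg _
  have hs : star q = q := hq0.isSelfAdjoint.star_eq
  -- Since `a⁻ a = -(a⁻)²`, the conjugate of `π a` by `q` is `-q³`. It is also nonnegative, as is
  -- `q³`, so `q³ = 0`.
  have h1 : q * π a * q = -(q * q * q) := by
    have h0 : a⁻ * a = -(a⁻ * a⁻) := by
      nth_rewrite 2 [← CFC.posPart_sub_negPart a ha]
      rw [mul_sub, CFC.negPart_mul_posPart, zero_sub]
    rw [hq, ← map_mul, h0, map_neg, map_mul, neg_mul]
  have h2 : 0 ≤ q * π a * q := by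
    have := star_left_conjugate_nonneg h q
    rwa [hs] at this
  have h3 : 0 ≤ q * q * q := by
    have := star_left_conjugate_nonneg hq0 q
    rwa [hs] at this
  have h4 : q * q * q = 0 := le_antisymm (neg_nonneg.mp (h1 ▸ h2)) h3
  -- From `q⁴ = 0` the C*-identity, used twice, gives `q² = 0` and then `q = 0`.
  have h5 : star (q * q) * (q * q) = 0 := by
    rw [star_mul, hs, ← mul_assoc, h4, zero_mul]
  have h6 : star q * q = 0 := by
    rw [hs]
    exact CStarRing.star_mul_self_eq_zero_iff _ |>.mp h5
  exact CStarRing.star_mul_self_eq_zero_iff _ |>.mp h6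

/-- Positivity of a self-adjoint element can be tested on a separating family of homomorphisms. -/
theorem exists_eq_star_mul_self_of_separating {A : Type u} [CStarAlgebra A] {a : A}
    (ha : star a = a) (h : ∀ p : A, p ≠ 0 → ∃ (B : Type v) (_ : CStarAlgebra B)
      (π : A →⋆ₙₐ[ℂ] B), π p ≠ 0 ∧ ∃ y, π a = star y * y) : ∃ y, a = star y * y := by
  let _ := CStarAlgebra.spectralOrder A
  let _ := CStarAlgebra.spectralOrderedRing A
  have ha' : IsSelfAdjoint a := ha
  rw [← CStarAlgebra.nonneg_iff_eq_star_mul_self, ← CFC.negPart_eq_zero_iff a ha']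
  by_contra hne
  -- Only the negative part of `a` has to be separated from zero.
  obtain ⟨B, _, π, hπ, hy⟩ := h _ hne
  let _ := CStarAlgebra.spectralOrder B
  let _ := CStarAlgebra.spectralOrderedRing B
  exact hπ (map_negPart_eq_zero π ha' (CStarAlgebra.nonneg_iff_eq_star_mul_self.mpr hy))

/-- Positivity of a hermitian matrix over a C*-algebra can be tested on a separating family of
homomorphisms. -/
theorem mem_matrixPos_of_separating {A : Type u} [CStarAlgebra A] {n : ℕ}
    {X : Matrix (Fin n) (Fin n) A} (hX : Xᴴ = X)
    (h : ∀ z : A, z ≠ 0 → ∃ (B : Type v) (_ : CStarAlgebra B) (π : A →⋆ₐ[ℂ] B),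
      π z ≠ 0 ∧ X.map π ∈ matrixPos B n) : X ∈ matrixPos A n := by
  let _ := CStarAlgebra.spectralOrder A
  let _ := CStarAlgebra.spectralOrderedRing A
  refine exists_eq_star_mul_self_of_separating (A := CStarMatrix (Fin n) (Fin n) A) (a := X) hX
    fun p hp => ?_
  -- A homomorphism that does not kill some entry of `p` has an amplification that does not kill
  -- `p`.
  obtain ⟨i, j, hij⟩ : ∃ i j, p i j ≠ 0 := by
    by_contra! h0
    exact hp (CStarMatrix.ext h0)
  obtain ⟨B, _, π, hπ, Y, hY⟩ := h _ hij
  let _ := CStarAlgebra.spectralOrder B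
  let _ := CStarAlgebra.spectralOrderedRing B
  exact ⟨CStarMatrix (Fin n) (Fin n) B, inferInstance,
    CStarMatrix.mapₙₐ (π : A →⋆ₙₐ[ℂ] B), fun h0 => hπ (congrFun (congrFun h0 i) j), Y, hY⟩

/-! ### The universal property of the universal C*-algebra. -/

namespace UniversalCStar

variable {S : Type u} [AddCommGroup S] [Module ℂ S] [StarAddMonoid S] [StarModule ℂ S]
  [OperatorSystem S]

/-- The seminorm is a supremum in which `φ` takes part; this needs `B` to lie in the universe of
`S`. -/
theorem lipschitz_lift {B : Type u} [CStarAlgebra B] {φ : S →ₗ[ℂ] B} (hφ : IsUCP φ) :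
    LipschitzWith 1 (FreeStarAlgebra.lift φ) :=
  AddMonoidHomClass.lipschitz_of_bound_nnnorm _ 1 fun x => by
    rw [one_mul]
    exact FreeStarAlgebra.norm_lift_le hφ x

/-- The ring homomorphism on the universal C*-algebra that extends a unital completely positive
map. -/
noncomputable def liftRingHom {B : Type u} [CStarAlgebra B] (φ : S →ₗ[ℂ] B) (hφ : IsUCP φ) :
    UniversalCStar S →+* B :=
  UniformSpace.Completion.extensionHom (FreeStarAlgebra.lift φ : FreeStarAlgebra S →+* B)
    (lipschitz_lift hφ).continuous

theorem liftRingHom_ofFree {B : Type u} [CStarAlgebra B] (φ : S →ₗ[ℂ] B) (hφ : IsUCP φ)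
    (x : FreeStarAlgebra S) : liftRingHom φ hφ (ofFree S x) = FreeStarAlgebra.lift φ x :=
  UniformSpace.Completion.extensionHom_coe
    (FreeStarAlgebra.lift φ : FreeStarAlgebra S →+* B) (lipschitz_lift hφ).continuous x

theorem continuous_liftRingHom {B : Type u} [CStarAlgebra B] (φ : S →ₗ[ℂ] B) (hφ : IsUCP φ) :
    Continuous (liftRingHom φ hφ) :=
  UniformSpace.Completion.continuous_extension

/-- The universal property of the universal C*-algebra. -/
noncomputable def lift {B : Type u} [CStarAlgebra B] (φ : S →ₗ[ℂ] B) (hφ : IsUCP φ) :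
    UniversalCStar S →⋆ₐ[ℂ] B where
  __ := liftRingHom φ hφ
  commutes' c := by
    have := liftRingHom_ofFree φ hφ (algebraMap ℂ _ c)
    rwa [AlgHom.commutes, AlgHom.commutes] at this
  map_star' a := by
    have h1 := continuous_star' S
    have h2 := continuous_liftRingHom φ hφ
    refine induction_on (p := fun a => liftRingHom φ hφ (star a) = star (liftRingHom φ hφ a))
      (isClosed_eq (h2.comp h1) (continuous_star.comp h2)) (fun x => ?_) a
    rw [star_ofFree, liftRingHom_ofFree, liftRingHom_ofFree, FreeStarAlgebra.lift_star hφ]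

theorem lift_ofFree {B : Type u} [CStarAlgebra B] (φ : S →ₗ[ℂ] B) (hφ : IsUCP φ)
    (x : FreeStarAlgebra S) : lift φ hφ (ofFree S x) = FreeStarAlgebra.lift φ x :=
  liftRingHom_ofFree φ hφ x

theorem lift_ι {B : Type u} [CStarAlgebra B] (φ : S →ₗ[ℂ] B) (hφ : IsUCP φ) (s : S) :
    lift φ hφ (ι S s) = φ s :=
  (lift_ofFree φ hφ _).trans (FreeStarAlgebra.lift_gen φ s)

open scoped CStarAlgebra in
-- The free algebra is generated by `S` and has dense image, and *-homomorphisms of C*-algebras are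
-- automatically continuous.
theorem hom_ext {B : Type v} [CStarAlgebra B] {f g : UniversalCStar S →⋆ₐ[ℂ] B}
    (h : ∀ s, f (ι S s) = g (ι S s)) : f = g := by
  have hc : ∀ f : UniversalCStar S →⋆ₐ[ℂ] B, Continuous f := fun f => map_continuous f
  ext a
  refine induction_on (p := fun a => f a = g a) (isClosed_eq (hc f) (hc g)) (fun x => ?_) a
  exact DFunLike.congr_fun (FreeStarAlgebra.hom_ext
    (f := (f : UniversalCStar S →ₐ[ℂ] B).comp (ofFree S))
    (g := (g : UniversalCStar S →ₐ[ℂ] B).comp (ofFree S)) h) x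

/-- If every lift killed `z`, then each `x` in the free algebra would satisfy `‖lift φ x‖ ≤ ‖z - x‖`
for all `φ`, so `‖x‖ ≤ ‖z - x‖` and `‖z‖ ≤ 2 ‖z - x‖`. This fails for `x` close to `z`. -/
theorem exists_lift_ne_zero {z : UniversalCStar S} (hz : z ≠ 0) :
    ∃ (B : Type u) (_ : CStarAlgebra B) (φ : S →ₗ[ℂ] B) (hφ : IsUCP φ), lift φ hφ z ≠ 0 := by
  by_contra! h
  have hpos : 0 < ‖z‖ := norm_pos_iff.mpr hz
  obtain ⟨x, hx⟩ := Metric.denseRange_iff.mp (denseRange_ofFree S) z (‖z‖ / 2) (half_pos hpos)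
  rw [dist_eq_norm] at hx
  have h1 : ‖x‖ ≤ ‖z - ofFree S x‖ := FreeStarAlgebra.norm_le (norm_nonneg _) fun B _ φ hφ => by
    rw [← lift_ofFree φ hφ, ← norm_neg, ← zero_sub, ← h B _ φ hφ, ← map_sub]
    exact NonUnitalStarAlgHom.norm_apply_le (lift φ hφ) _
  have h2 : ‖z‖ ≤ ‖z - ofFree S x‖ + ‖ofFree S x‖ := by
    simpa using norm_add_le (z - ofFree S x) (ofFree S x)
  rw [norm_ofFree] at h2
  linarith

/-- In the free algebra the generator of the order unit differs from `1`; they become equal in the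
completion because the seminorm involves unital maps only. -/
theorem ι_unit : ι S unit = 1 := by
  by_contra h
  obtain ⟨B, _, φ, hφ, hne⟩ := exists_lift_ne_zero (sub_ne_zero.mpr h)
  rw [map_sub, map_one, lift_ι, hφ.map_unit] at hne
  exact hne (sub_self _)

/-- The lifts separate points, and each of them carries the image of a positive matrix `X` to the
positive matrix `X.map φ`. -/
theorem isUCP_ι : IsUCP (ι S) where
  map_unit := ι_unit
  map_cone {n X} hX := by
    refine mem_matrixPos_of_separating ?_ fun z hz => ?_
    · conv_rhs => rw [← conjTranspose_eq hX]
      ext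
      simp [star_ι]
    · obtain ⟨B, _, φ, hφ, hne⟩ := exists_lift_ne_zero hz
      refine ⟨B, _, lift φ hφ, hne, ?_⟩
      have h : ((X.map (ι S)).map (lift φ hφ)) = X.map φ := by
        ext i j
        exact lift_ι φ hφ (X i j)
      exact h ▸ hφ.map_cone hX

end UniversalCStar
end OperatorSystem

namespace OperatorSystem

/-! ### Separation from the matrix cones by positive functionals. -/

section Separation

open scoped ComplexOrder ComplexStarModule

variable {T : Type u} [AddCommGroup T] [Module ℂ T] [StarAddMonoid T] [StarModule ℂ T]
  [OperatorSystem T]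

theorem conjTranspose_diagonal_unit (n : ℕ) :
    (Matrix.diagonal fun _ => unit : Matrix (Fin n) (Fin n) T)ᴴ = Matrix.diagonal fun _ => unit :=
  conjTranspose_eq (diagonal_unit_mem n)

/-- The hermitian matrices that lie in the cone after adding a nonnegative multiple of `Z`. -/
def hermitianCone {n : ℕ} (Z : Matrix (Fin n) (Fin n) T) :
    PointedCone ℝ (selfAdjoint (Matrix (Fin n) (Fin n) T)) where
  carrier := {Y | ∃ t : ℝ, 0 ≤ t ∧ (Y : Matrix (Fin n) (Fin n) T) + (t : ℂ) • Z ∈ cone n}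
  zero_mem' := ⟨0, le_rfl, by simpa using zero_mem n⟩
  add_mem' := by
    rintro Y W ⟨t, ht, hY⟩ ⟨s, hs, hW⟩
    refine ⟨t + s, add_nonneg ht hs, ?_⟩
    convert add_mem hY hW using 1
    push_cast
    rw [add_smul]
    abel
  smul_mem' := by
    rintro ⟨c, hc⟩ Y ⟨t, ht, hY⟩
    refine ⟨c * t, mul_nonneg hc ht, ?_⟩
    convert smul_mem hc hY using 1
    rw [smul_add, smul_smul, Complex.ofReal_mul, Complex.coe_smul]
    rfl

/-- A hermitian matrix outside the cone is separated from it by a real functional. -/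
theorem exists_real_functional {n : ℕ} {X : Matrix (Fin n) (Fin n) T} (hX : Xᴴ = X)
    (h : X ∉ cone n) : ∃ g : selfAdjoint (Matrix (Fin n) (Fin n) T) →ₗ[ℝ] ℝ,
      (∀ Y : selfAdjoint (Matrix (Fin n) (Fin n) T), (Y : Matrix (Fin n) (Fin n) T) ∈ cone n →
        0 ≤ g Y) ∧ g ⟨X, hX⟩ < 0 := by
  -- The Archimedean property leaves a margin `r > 0`, which later makes the separation strict.
  obtain ⟨r, hr, hZ⟩ : ∃ r : ℝ, 0 < r ∧ (r : ℂ) • Matrix.diagonal (fun _ => unit) + X ∉ cone n := by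
    by_contra! h0
    exact h (archimedean h0)
  let e : selfAdjoint (Matrix (Fin n) (Fin n) T) := ⟨_, conjTranspose_diagonal_unit n⟩
  let X' : selfAdjoint (Matrix (Fin n) (Fin n) T) := ⟨X, hX⟩
  set Z : Matrix (Fin n) (Fin n) T := (r : ℂ) • Matrix.diagonal (fun _ => unit) + X with hZdef
  have hZ' : ((r • e + X' : selfAdjoint (Matrix (Fin n) (Fin n) T)) :
      Matrix (Fin n) (Fin n) T) = Z := by
    rw [hZdef, Complex.coe_smul]
    rfl
  -- If the unit vanished, the order unit property for `-X` would put `X` in the cone.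
  have he : e ≠ 0 := by
    intro he
    have he' : (Matrix.diagonal fun _ => unit : Matrix (Fin n) (Fin n) T) = 0 :=
      congrArg Subtype.val he
    obtain ⟨t, ht, hs⟩ := order_unit (V := T) (n := n) (X := -X)
      (by rw [Matrix.conjTranspose_neg, hX])
    rw [he', smul_zero, zero_sub, neg_neg] at hs
    exact h hs
  let f : selfAdjoint (Matrix (Fin n) (Fin n) T) →ₗ.[ℝ] ℝ := LinearPMap.mkSpanSingleton e 1 he
  -- The functional `a e ↦ a` is nonnegative on the cone enlarged by `-Z`: if `a e + t Z` is
  -- positive with `a < 0`, then so is `t Z`. For `t > 0` this contradicts the choice of `Z`; for `t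
  -- = 0` already `-e` is positive, which forces `e = 0`. Cofinality is the order unit property.
  obtain ⟨g, hgf, hg⟩ := riesz_extension (hermitianCone Z) f (by
    rintro ⟨x, hx⟩ hxc
    obtain ⟨a, rfl⟩ := Submodule.mem_span_singleton.mp hx
    rw [LinearPMap.mkSpanSingleton'_apply, RingHom.id_apply, smul_eq_mul, mul_one]
    obtain ⟨t, ht, hm⟩ := hxc
    by_contra! ha
    have hm' : (t : ℂ) • Z ∈ cone n := by
      have := add_mem hm (smul_unit_mem (S := T) n (neg_nonneg.mpr ha.le))
      convert this using 1
      have h1 : ((a • e : selfAdjoint (Matrix (Fin n) (Fin n) T)) : Matrix (Fin n) (Fin n) T) =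
        (a : ℂ) • Matrix.diagonal (fun _ => unit) := by rw [Complex.coe_smul]; rfl
      simp only [h1, Complex.ofReal_neg, neg_smul]
      abel
    rcases ht.eq_or_lt with rfl | ht
    · refine he (Subtype.ext (eq_zero (diagonal_unit_mem n) ?_))
      have := smul_mem (r := (-a)⁻¹) (inv_nonneg.mpr (neg_nonneg.mpr ha.le)) hm
      convert this using 1
      have h1 : ((a • e : selfAdjoint (Matrix (Fin n) (Fin n) T)) : Matrix (Fin n) (Fin n) T) =
        (a : ℂ) • Matrix.diagonal (fun _ => unit) := by rw [Complex.coe_smul]; rfl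
      simp only [h1, Complex.ofReal_zero, zero_smul, add_zero, smul_smul]
      rw [← Complex.ofReal_mul, inv_neg, neg_mul, inv_mul_cancel₀ ha.ne, Complex.ofReal_neg,
        Complex.ofReal_one, neg_smul, one_smul]
    · have := smul_mem (r := t⁻¹) (inv_nonneg.mpr ht.le) hm'
      rw [smul_smul, ← Complex.ofReal_mul, inv_mul_cancel₀ ht.ne', Complex.ofReal_one,
        one_smul] at this
      exact hZ this) (by
    intro y
    obtain ⟨t, ht, hs⟩ := order_unit (V := T) (n := n)
      (X := -(y : Matrix (Fin n) (Fin n) T)) (by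
        rw [Matrix.conjTranspose_neg]
        exact congrArg Neg.neg y.2)
    refine ⟨⟨t • e, Submodule.smul_mem _ _ (Submodule.mem_span_singleton_self e)⟩, 0, le_rfl, ?_⟩
    rw [sub_neg_eq_add, Complex.coe_smul] at hs
    simpa using hs)
  refine ⟨g, fun Y hY => hg Y ⟨0, le_rfl, by simpa using hY⟩, ?_⟩
  have hge : g e = 1 := by
    have := hgf ⟨e, Submodule.mem_span_singleton_self e⟩
    rw [this]
    exact LinearPMap.mkSpanSingleton_apply ℝ ℝ he 1
  -- As `-Z` lies in the enlarged cone, `g Z ≤ 0`; with `g e = 1` this reads `g X ≤ -r`.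
  have hgZ : 0 ≤ g (-(r • e + X')) := hg _ ⟨1, zero_le_one, by
    have h1 : ((-(r • e + X') : selfAdjoint (Matrix (Fin n) (Fin n) T)) :
      Matrix (Fin n) (Fin n) T) = -Z := congrArg Neg.neg hZ'
    rw [h1, Complex.ofReal_one, one_smul, neg_add_cancel]
    exact zero_mem n⟩
  rw [map_neg, map_add, map_smul, hge, smul_eq_mul, mul_one] at hgZ
  change g X' < 0
  linarith

/-- Positive functionals on the matrices over an operator system. -/
structure IsPositiveFunctional {n : ℕ} (f : Matrix (Fin n) (Fin n) T →ₗ[ℂ] ℂ) : Prop where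
  nonneg : ∀ {Y : Matrix (Fin n) (Fin n) T}, Y ∈ cone n → 0 ≤ f Y

namespace IsPositiveFunctional

variable {n : ℕ} {f : Matrix (Fin n) (Fin n) T →ₗ[ℂ] ℂ}

theorem star_of_hermitian (hf : IsPositiveFunctional f)
    {Y : Matrix (Fin n) (Fin n) T} (hY : Yᴴ = Y) : star (f Y) = f Y := by
  obtain ⟨r, -, h⟩ := order_unit hY
  have h1 := (IsSelfAdjoint.of_nonneg (hf.nonneg h)).star_eq
  have h2 := (IsSelfAdjoint.of_nonneg (hf.nonneg (diagonal_unit_mem (S := T) n))).star_eq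
  rw [map_sub, map_smul, star_sub, star_smul, h2] at h1
  simpa using h1

theorem map_conjTranspose (hf : IsPositiveFunctional f) (Y : Matrix (Fin n) (Fin n) T) : f Yᴴ = star (f Y) := by
  obtain ⟨a, b, ha, hb, rfl⟩ := selfAdjoint_decomp Y
  have ha' : aᴴ = a := ha
  have hb' : bᴴ = b := hb
  simp only [Matrix.conjTranspose_add, Matrix.conjTranspose_smul, ha', hb', map_add, map_smul,
    star_add, star_smul, hf.star_of_hermitian ha', hf.star_of_hermitian hb']

/-- Some `r e + X` is positive, so `f X ≥ -r f(e)`, which excludes `f(e) = 0`. -/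
theorem unit_pos (hf : IsPositiveFunctional f) {X : Matrix (Fin n) (Fin n) T}
    (hX : Xᴴ = X) (h : f X < 0) :
    0 < f (Matrix.diagonal fun _ => unit) := by
  refine lt_of_le_of_ne (hf.nonneg (diagonal_unit_mem n)) fun h0 => ?_
  obtain ⟨r, -, hr⟩ := order_unit (V := T) (X := -X) (by rw [Matrix.conjTranspose_neg, hX])
  have h1 := hf.nonneg hr
  rw [map_sub, map_smul, ← h0, smul_zero, map_neg, zero_sub, neg_neg] at h1
  exact absurd h (not_lt_of_ge h1)

end IsPositiveFunctional

/-- A hermitian matrix outside the cone is separated from it by a positive functional. -/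
theorem exists_isPositiveFunctional {n : ℕ} {X : Matrix (Fin n) (Fin n) T} (hX : Xᴴ = X)
    (h : X ∉ cone n) :
    ∃ f : Matrix (Fin n) (Fin n) T →ₗ[ℂ] ℂ, IsPositiveFunctional f ∧ f X < 0 := by
  obtain ⟨g, hg, hgX⟩ := exists_real_functional hX h
  -- The complex extension is `Y ↦ g (Re Y) - i g (Re (iY))`, and `Re (iY) = -Im Y` vanishes for
  -- hermitian `Y`.
  have key : ∀ Y (hY : Yᴴ = Y), Module.Dual.extendRCLike (𝕜 := ℂ) (g ∘ₗ realPart) Y = (g ⟨Y, hY⟩ : ℂ) := by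
    intro Y hY
    have h1 : realPart Y = ⟨Y, hY⟩ := Subtype.ext (IsSelfAdjoint.coe_realPart hY)
    have h2 : imaginaryPart Y = 0 := IsSelfAdjoint.imaginaryPart hY
    rw [Module.Dual.extendRCLike_apply]
    simp [realPart_I_smul, h1, h2]
  refine ⟨Module.Dual.extendRCLike (𝕜 := ℂ) (g ∘ₗ realPart), ⟨fun {Y} hY => ?_⟩, ?_⟩
  · rw [key Y (conjTranspose_eq hY)]
    exact_mod_cast hg _ hY
  · rw [key X hX]
    exact_mod_cast hgX

end Separation
end OperatorSystem

namespace OperatorSystem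

/-! ### From positive functionals to unital completely positive maps into matrix algebras. -/

section MatrixValued

open scoped ComplexOrder

/-- The quadratic form of a matrix of scalar matrices. -/
def blockForm {m : ℕ} {κ : Type*} [Fintype κ] (M : Matrix (Fin m) (Fin m) (Matrix κ κ ℂ))
    (v : Fin m → κ → ℂ) : ℂ :=
  ∑ p, ∑ q, star (v p) ⬝ᵥ (M p q *ᵥ v q)

/-- Flattening the blocks identifies this form with an ordinary quadratic form, so that scalar
positive semidefiniteness applies to block matrices. -/
theorem blockForm_eq_comp {m : ℕ} {κ : Type*} [Fintype κ]
    (M : Matrix (Fin m) (Fin m) (Matrix κ κ ℂ)) (w : Fin m × κ → ℂ) :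
    star w ⬝ᵥ (Matrix.comp _ _ _ _ _ M *ᵥ w) = blockForm M fun p i => w (p, i) := by
  simp only [blockForm, dotProduct, Matrix.mulVec, Fintype.sum_prod_type, Matrix.comp_apply,
    Pi.star_apply, Finset.mul_sum]
  refine Finset.sum_congr rfl fun p _ => ?_
  rw [Finset.sum_comm]

theorem blockForm_conjTranspose_mul_self_nonneg {m : ℕ} {κ : Type*} [Fintype κ]
    (Y : Matrix (Fin m) (Fin m) (Matrix κ κ ℂ)) (v : Fin m → κ → ℂ) :
    0 ≤ blockForm (Yᴴ * Y) v := by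
  have h := (Matrix.posSemidef_conjTranspose_mul_self
    (Matrix.comp _ _ _ _ _ Y)).dotProduct_mulVec_nonneg (fun p => v p.1 p.2)
  have h1 : (Matrix.comp _ _ _ _ _ Y)ᴴ * Matrix.comp _ _ _ _ _ Y =
      Matrix.comp _ _ _ _ _ (Yᴴ * Y) :=
    ((Matrix.compRingEquiv (Fin m) κ ℂ).map_mul Yᴴ Y).symm
  rwa [h1, blockForm_eq_comp] at h

open scoped MatrixOrder in
theorem exists_eq_conjTranspose_mul_self {κ : Type*} [Fintype κ] {M : Matrix κ κ ℂ}
    (hM : M.PosSemidef) : ∃ B : Matrix κ κ ℂ, M = Bᴴ * B := by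
  classical
  exact CStarAlgebra.nonneg_iff_eq_star_mul_self.mp hM.nonneg

/-- The flattened matrix is positive semidefinite, and its factorization is transported back along
the ring isomorphism that flattens blocks. -/
theorem exists_eq_conjTranspose_mul_self_of_blockForm {m : ℕ} {κ : Type*} [Fintype κ]
    {M : Matrix (Fin m) (Fin m) (Matrix κ κ ℂ)} (hM : Mᴴ = M) (h : ∀ v, 0 ≤ blockForm M v) :
    ∃ Y, M = Yᴴ * Y := by
  have h1 : (Matrix.comp _ _ _ _ _ M).PosSemidef := by
    refine Matrix.PosSemidef.of_dotProduct_mulVec_nonneg ?_ fun w => ?_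
    · exact congrArg (Matrix.comp _ _ _ _ _) hM
    · rw [blockForm_eq_comp]
      exact h _
  obtain ⟨B, hB⟩ := exists_eq_conjTranspose_mul_self h1
  refine ⟨(Matrix.comp _ _ _ _ _).symm B, (Matrix.comp _ _ _ _ _).injective ?_⟩
  rw [hB]
  exact ((Matrix.compRingEquiv (Fin m) κ ℂ).map_mul
    ((Matrix.comp _ _ _ _ _).symm B)ᴴ ((Matrix.comp _ _ _ _ _).symm B)).symm

theorem blockForm_conjugate {m : ℕ} {κ : Type*} [Fintype κ]
    (M : Matrix (Fin m) (Fin m) (Matrix κ κ ℂ)) (R : Matrix κ κ ℂ) (v : Fin m → κ → ℂ) :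
    blockForm (M.map fun N => Rᴴ * N * R) v = blockForm M fun p => R *ᵥ v p := by
  simp only [blockForm, Matrix.map_apply]
  refine Finset.sum_congr rfl fun p _ => Finset.sum_congr rfl fun q _ => ?_
  rw [← Matrix.mulVec_mulVec, ← Matrix.mulVec_mulVec, Matrix.dotProduct_mulVec,
    Matrix.star_mulVec]

variable {T : Type u} [AddCommGroup T] [Module ℂ T]

/-- The matrix-valued map attached to a functional on matrices. -/
def matrixMap {n : ℕ} {κ : Type*} (σ : κ → Fin n) (f : Matrix (Fin n) (Fin n) T →ₗ[ℂ] ℂ) :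
    T →ₗ[ℂ] Matrix κ κ ℂ where
  toFun t := Matrix.of fun i j => f (Matrix.single (σ i) (σ j) t)
  map_add' s t := by
    ext i j
    simp [Matrix.single_add]
  map_smul' c t := by
    ext i j
    simp [← Matrix.smul_single]

theorem matrixMap_apply {n : ℕ} {κ : Type*} (σ : κ → Fin n)
    (f : Matrix (Fin n) (Fin n) T →ₗ[ℂ] ℂ) (t : T) (i j : κ) :
    matrixMap σ f t i j = f (Matrix.single (σ i) (σ j) t) := rfl

/-- The quadratic form of `matrixMap` is the functional at a compression. -/
theorem blockForm_matrixMap {n m : ℕ} {κ : Type*} [Fintype κ] (σ : κ ≃ Fin n)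
    (f : Matrix (Fin n) (Fin n) T →ₗ[ℂ] ℂ) (Y : Matrix (Fin m) (Fin m) T) (v : Fin m → κ → ℂ) :
    blockForm (Y.map (matrixMap σ f)) v =
      f ((Matrix.of fun p i => v p (σ.symm i) : Matrix (Fin m) (Fin n) ℂ).compress Y) := by
  rw [Matrix.matrix_eq_sum_single (Matrix.compress _ _)]
  simp only [map_sum, blockForm, dotProduct, Matrix.mulVec, Finset.mul_sum, Matrix.compress,
    Matrix.of_apply, Matrix.map_apply, matrixMap_apply, Pi.star_apply]
  have h1 : ∀ i j : Fin n, f (Matrix.single i j (∑ k, ∑ l,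
      (star (v k (σ.symm i)) * v l (σ.symm j)) • Y k l)) =
      ∑ k, ∑ l, star (v k (σ.symm i)) * (f (Matrix.single i j (Y k l)) * v l (σ.symm j)) := by
    intro i j
    have h2 : ∀ t, f (Matrix.single i j t) = (f ∘ₗ Matrix.singleLinearMap ℂ i j) t := fun _ => rfl
    simp only [h2, map_sum, map_smul, smul_eq_mul]
    refine Finset.sum_congr rfl fun k _ => Finset.sum_congr rfl fun l _ => by ring
  simp only [h1]
  -- Only a reordering of the sums is left, followed by reindexing `κ` along `σ`.
  calc _ = ∑ p, ∑ i, ∑ q, ∑ j, star (v p i) *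
        (f (Matrix.single (σ i) (σ j) (Y p q)) * v q j) :=
      Finset.sum_congr rfl fun p _ => Finset.sum_comm
    _ = ∑ i, ∑ j, ∑ p, ∑ q, star (v p i) *
        (f (Matrix.single (σ i) (σ j) (Y p q)) * v q j) := by
      rw [Finset.sum_comm]
      refine Finset.sum_congr rfl fun i _ => ?_
      rw [Finset.sum_comm (s := Finset.univ (α := κ))]
      exact Finset.sum_congr rfl fun p _ => Finset.sum_comm
    _ = _ := by
      rw [← σ.sum_comp]
      refine Finset.sum_congr rfl fun i _ => ?_
      refine Eq.trans ?_ (σ.sum_comp _)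
      simp only [Equiv.symm_apply_apply]

/-- The functional `X ↦ ∑ i j, f (E_ii ⊗ X_jj)`. -/
def traceFunctional {n : ℕ} (f : Matrix (Fin n) (Fin n) T →ₗ[ℂ] ℂ) :
    Matrix (Fin n) (Fin n) T →ₗ[ℂ] ℂ :=
  ∑ i, ∑ j, f ∘ₗ Matrix.singleLinearMap ℂ i i ∘ₗ Matrix.entryLinearMap ℂ T j j

theorem traceFunctional_apply {n : ℕ} (f : Matrix (Fin n) (Fin n) T →ₗ[ℂ] ℂ)
    (X : Matrix (Fin n) (Fin n) T) :
    traceFunctional f X = ∑ i, ∑ j, f (Matrix.single i i (X j j)) := by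
  simp [traceFunctional, LinearMap.sum_apply]

/-- At the standard basis vectors the compressing scalar matrix is the identity. A negative `f X`
thus shows that the image of `X` is not positive. -/
theorem blockForm_matrixMap_single {n : ℕ} {κ : Type*} [Fintype κ] [DecidableEq κ]
    (σ : κ ≃ Fin n) (f : Matrix (Fin n) (Fin n) T →ₗ[ℂ] ℂ) (X : Matrix (Fin n) (Fin n) T) :
    blockForm (X.map (matrixMap σ f)) (fun p => Pi.single (σ.symm p) 1) = f X := by
  rw [blockForm_matrixMap]
  congr 1
  ext i j
  simp only [Matrix.compress, Matrix.of_apply, Pi.single_apply, EmbeddingLike.apply_eq_iff_eq]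
  rw [Finset.sum_eq_single i, Finset.sum_eq_single j]
  · simp
  · intro l _ hl
    simp [hl.symm]
  · simp
  · intro l _ hl
    simp [hl.symm]
  · simp

variable [StarAddMonoid T] [StarModule ℂ T] [OperatorSystem T]

theorem IsPositiveFunctional.matrixMap_star {n : ℕ} {κ : Type*} (σ : κ → Fin n)
    {f : Matrix (Fin n) (Fin n) T →ₗ[ℂ] ℂ} (hf : IsPositiveFunctional f) (t : T) :
    matrixMap σ f (star t) = (matrixMap σ f t)ᴴ := by
  ext i j
  rw [Matrix.conjTranspose_apply, matrixMap_apply, matrixMap_apply, ← hf.map_conjTranspose,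
    Matrix.conjTranspose_single]

/-- `traceFunctional f` is the trace followed by `t ↦ ∑ i, f (E_ii ⊗ t)`, and `E_ab ⊗ e` has trace
`δ_ab e`. Adding a multiple of this functional therefore shifts the value at the unit by a scalar
matrix. -/
theorem matrixMap_traceFunctional_unit {n : ℕ} {κ : Type*} [DecidableEq κ] (σ : κ ≃ Fin n)
    (f : Matrix (Fin n) (Fin n) T →ₗ[ℂ] ℂ) :
    matrixMap σ (traceFunctional f) unit =
      f (Matrix.diagonal fun _ => unit) • (1 : Matrix κ κ ℂ) := by
  have h : f (Matrix.diagonal fun _ => unit) = ∑ i, f (Matrix.single i i unit) := by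
    rw [← map_sum, Matrix.sum_single_eq_diagonal]
  ext a b
  rw [matrixMap_apply, traceFunctional_apply, h]
  rcases eq_or_ne a b with rfl | hab
  · simp only [Matrix.smul_apply, Matrix.one_apply_eq, smul_eq_mul, mul_one]
    refine Finset.sum_congr rfl fun i _ => ?_
    rw [Finset.sum_eq_single (σ a)]
    · simp
    · intro j _ hj
      rw [Matrix.single_apply_of_ne _ _ _ _ _ (by tauto)]
      simp
    · simp
  · have h0 : ∀ j, (Matrix.single (σ a) (σ b) (unit : T)) j j = 0 := fun j =>
      Matrix.single_apply_of_ne _ _ _ _ _ fun hj => hab (σ.injective (hj.1.trans hj.2.symm))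
    simp [h0, hab]

/-- Each `E_ii ⊗ Y_jj` is the compression of `Y` by the matrix unit `E_ji`. -/
theorem IsPositiveFunctional.traceFunctional {n : ℕ} {f : Matrix (Fin n) (Fin n) T →ₗ[ℂ] ℂ}
    (hf : IsPositiveFunctional f) : IsPositiveFunctional (traceFunctional f) where
  nonneg {Y} hY := by
    rw [traceFunctional_apply]
    refine Finset.sum_nonneg fun i _ => Finset.sum_nonneg fun j _ => ?_
    convert hf.nonneg (compress_mem (Matrix.single j i (1 : ℂ)) hY) using 2
    ext a b
    simp only [Matrix.compress, Matrix.of_apply, Matrix.single_apply]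
    rw [Finset.sum_eq_single j, Finset.sum_eq_single j]
    · by_cases ha : i = a <;> by_cases hb : i = b <;> simp [ha, hb]
    · intro l _ hl
      simp [hl.symm]
    · simp
    · intro l _ hl
      simp [hl.symm]
    · simp

/-- The quadratic form at `w` is `f` at the compression of the `1 × 1` matrix `e` by the row `w`. -/
theorem IsPositiveFunctional.posSemidef_matrixMap_unit {n : ℕ} {κ : Type*} [Fintype κ]
    (σ : κ ≃ Fin n) {f : Matrix (Fin n) (Fin n) T →ₗ[ℂ] ℂ} (hf : IsPositiveFunctional f) :
    (matrixMap σ f unit).PosSemidef := by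
  refine Matrix.PosSemidef.of_dotProduct_mulVec_nonneg ?_ fun w => ?_
  · have h := hf.matrixMap_star σ unit
    rw [star_unit] at h
    exact h.symm
  · have h := hf.nonneg (compress_mem (Matrix.of fun (p : Fin 1) i => w (σ.symm i))
      (diagonal_unit_mem (S := T) 1))
    rw [← blockForm_matrixMap σ f _ fun _ => w] at h
    simpa [blockForm] using h

/-- A hermitian matrix outside the cone is separated from it by a positive functional whose
matrix-valued map takes a positive definite value at the unit. -/
theorem exists_isPositiveFunctional_posDef {n : ℕ} {κ : Type*} [Fintype κ] (σ : κ ≃ Fin n)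
    {X : Matrix (Fin n) (Fin n) T} (hX : Xᴴ = X) (h : X ∉ cone n) :
    ∃ f : Matrix (Fin n) (Fin n) T →ₗ[ℂ] ℂ, IsPositiveFunctional f ∧ f X < 0 ∧
      (matrixMap σ f unit).PosDef := by
  classical
  obtain ⟨f, hf, hfX⟩ := exists_isPositiveFunctional hX h
  have hfu := hf.unit_pos hX hfX
  have hre : (f X).re < 0 := (Complex.lt_def.mp hfX).1
  set τ := traceFunctional f with hτ
  have hτp : IsPositiveFunctional τ := hf.traceFunctional
  have hτX : τ X = ((τ X).re : ℂ) :=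
    (Complex.conj_eq_iff_re.mp (hτp.star_of_hermitian hX)).symm
  have hfXr : f X = ((f X).re : ℂ) :=
    (Complex.conj_eq_iff_re.mp (hf.star_of_hermitian hX)).symm
  -- This size gives `δ |τ X| ≤ |f X| / 2`, so the perturbed functional stays negative at `X`; the
  -- `+ 1` keeps the denominator positive.
  set δ : ℝ := -(f X).re / (2 * (|(τ X).re| + 1)) with hδ
  have hδ0 : 0 < δ := div_pos (neg_pos.mpr hre) (by positivity)
  have hδ0' : (0 : ℂ) < δ := by exact_mod_cast hδ0
  refine ⟨f + (δ : ℂ) • τ, ⟨fun {Y} hY => ?_⟩, ?_, ?_⟩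
  · exact add_nonneg (hf.nonneg hY) (mul_nonneg hδ0'.le (hτp.nonneg hY))
  · have h1 : (f X).re + δ * (τ X).re < 0 := by
      have h2 : δ * (τ X).re ≤ δ * (|(τ X).re| + 1) :=
        mul_le_mul_of_nonneg_left ((le_abs_self _).trans (le_add_of_nonneg_right zero_le_one))
          hδ0.le
      have h3 : δ * (|(τ X).re| + 1) = -(f X).re / 2 := by
        rw [hδ]
        field_simp
      linarith
    rw [LinearMap.add_apply, LinearMap.smul_apply, hfXr, hτX, smul_eq_mul]
    exact_mod_cast h1
  · have h1 : matrixMap σ (f + (δ : ℂ) • τ) unit =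
        matrixMap σ f unit + ((δ : ℂ) * f (Matrix.diagonal fun _ => unit)) • 1 := by
      rw [mul_smul, ← matrixMap_traceFunctional_unit σ f]
      rfl
    rw [h1]
    exact Matrix.PosDef.posSemidef_add (hf.posSemidef_matrixMap_unit σ)
      (Matrix.PosDef.one.smul (mul_pos hδ0' hfu))

/-- Unital completely positive maps into C*-algebras detect positivity of hermitian matrices. -/
theorem exists_isUCP_notMem {n : ℕ} {X : Matrix (Fin n) (Fin n) T} (hX : Xᴴ = X)
    (h : X ∉ cone n) : ∃ (B : Type u) (_ : CStarAlgebra B) (φ : T →ₗ[ℂ] B),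
      IsUCP φ ∧ X.map φ ∉ matrixPos B n := by
  -- Lifting the index type places the matrix algebra in the universe of `T`.
  let σ : ULift.{u} (Fin n) ≃ Fin n := Equiv.ulift
  obtain ⟨f, hf, hfX, hP⟩ := exists_isPositiveFunctional_posDef σ hX h
  obtain ⟨C, hC⟩ := exists_eq_conjTranspose_mul_self hP.posSemidef
  have hdet : IsUnit C.det := by
    have h1 : IsUnit (Cᴴ * C).det := (Matrix.isUnit_iff_isUnit_det _).mp (hC ▸ hP.isUnit)
    rw [Matrix.det_mul] at h1
    exact isUnit_of_mul_isUnit_right h1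
  -- The value at the unit is `Cᴴ C` with `C` invertible, so conjugation by `C⁻¹` normalizes the
  -- map.
  let ψ : T →ₗ[ℂ] Matrix (ULift.{u} (Fin n)) (ULift.{u} (Fin n)) ℂ :=
    LinearMap.mulRight ℂ C⁻¹ ∘ₗ LinearMap.mulLeft ℂ (C⁻¹)ᴴ ∘ₗ matrixMap σ f
  have hψ : ∀ t, ψ t = (C⁻¹)ᴴ * matrixMap σ f t * C⁻¹ := fun t => rfl
  have hform : ∀ {m : ℕ} (Y : Matrix (Fin m) (Fin m) T) (v : Fin m → ULift.{u} (Fin n) → ℂ),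
      blockForm (Y.map ψ) v = blockForm (Y.map (matrixMap σ f)) fun p => C⁻¹ *ᵥ v p :=
    fun Y v => blockForm_conjugate (Y.map (matrixMap σ f)) C⁻¹ v
  have hstar : ∀ t, ψ (star t) = star (ψ t) := fun t => by
    rw [hψ, hψ, hf.matrixMap_star, Matrix.star_eq_conjTranspose, Matrix.conjTranspose_mul,
      Matrix.conjTranspose_mul, Matrix.conjTranspose_conjTranspose, Matrix.mul_assoc]
  refine ⟨CStarMatrix (ULift.{u} (Fin n)) (ULift.{u} (Fin n)) ℂ, inferInstance, ψ, ⟨?_, ?_⟩, ?_⟩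
  · change ψ unit = 1
    rw [hψ, hC, Matrix.mul_assoc, Matrix.mul_assoc, Matrix.mul_nonsing_inv _ hdet, Matrix.mul_one,
      ← Matrix.conjTranspose_mul, Matrix.mul_nonsing_inv _ hdet, Matrix.conjTranspose_one]
  · intro m Y hY
    refine exists_eq_conjTranspose_mul_self_of_blockForm (M := Y.map ψ) ?_ fun v => ?_
    · conv_rhs => rw [← conjTranspose_eq hY]
      exact Matrix.ext fun p q => (hstar _).symm
    · rw [hform, blockForm_matrixMap]
      exact hf.nonneg (compress_mem _ hY)
  · rintro ⟨Y', hY'⟩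
    obtain ⟨Y, hY⟩ : ∃ Y : Matrix (Fin n) (Fin n)
        (Matrix (ULift.{u} (Fin n)) (ULift.{u} (Fin n)) ℂ), X.map ψ = Yᴴ * Y := ⟨Y', hY'⟩
    -- Applying `C` to the basis vectors cancels the normalization, so the form takes the value `f X
    -- < 0`.
    have h1 := blockForm_conjTranspose_mul_self_nonneg Y fun p => C *ᵥ Pi.single (σ.symm p) 1
    rw [← hY, hform] at h1
    simp only [Matrix.mulVec_mulVec, Matrix.nonsing_inv_mul _ hdet, Matrix.one_mulVec] at h1
    rw [blockForm_matrixMap_single] at h1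
    exact absurd hfX (not_lt_of_ge h1)

end MatrixValued
end OperatorSystem

namespace OperatorSystem

/-! ### The complete order embedding into the universal C*-algebra. -/

section Embedding

variable {S : Type u} [AddCommGroup S] [Module ℂ S] [StarAddMonoid S] [StarModule ℂ S]
  [OperatorSystem S]

/-- A completely positive map that detects `X ∉ cone n` factors through `ι` by a *-homomorphism,
which preserves positivity. -/
theorem mem_cone_of_map_ι {n : ℕ} {X : Matrix (Fin n) (Fin n) S} (hX : Xᴴ = X)
    (h : X.map (UniversalCStar.ι S) ∈ matrixPos (UniversalCStar S) n) : X ∈ cone n := by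
  by_contra hn
  obtain ⟨B, _, φ, hφ, hφX⟩ := exists_isUCP_notMem hX hn
  refine hφX ?_
  have h1 : (X.map (UniversalCStar.ι S)).map (UniversalCStar.lift φ hφ) = X.map φ := by
    ext i j
    exact UniversalCStar.lift_ι φ hφ (X i j)
  exact h1 ▸ map_mem_matrixPos (UniversalCStar.lift φ hφ) h

/-- Both `a` and `-a` have the positive image `0`, so both are positive, and the cone is proper. -/
theorem eq_zero_of_ι_eq_zero {a : S} (ha : star a = a) (h : UniversalCStar.ι S a = 0) :
    a = 0 := by
  have key : ∀ b : S, star b = b → UniversalCStar.ι S b = 0 →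
      (Matrix.of fun _ _ => b : Matrix (Fin 1) (Fin 1) S) ∈ cone 1 := by
    intro b hb h0
    refine mem_cone_of_map_ι (by ext i j; simpa using hb) ?_
    convert zero_mem_matrixPos 1 using 1
    ext i j
    exact h0
  have h1 := key a ha h
  have h2 := key (-a) (by rw [star_neg, ha]) (by rw [map_neg, h, neg_zero])
  exact congrFun (congrFun (eq_zero h1 h2) 0) 0

/-- The kernel is closed under the involution, so the hermitian case applies to `x + x*` and `i (x -
x*)`. -/
theorem ι_injective : Function.Injective (UniversalCStar.ι S) := by
  refine (injective_iff_map_eq_zero _).mpr fun x hx => ?_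
  have hx' : UniversalCStar.ι S (star x) = 0 := by rw [← UniversalCStar.star_ι, hx, star_zero]
  have h1 : x + star x = 0 := eq_zero_of_ι_eq_zero (by simp [add_comm])
    (by rw [map_add, hx, hx', add_zero])
  have h2 : Complex.I • (x - star x) = 0 := eq_zero_of_ι_eq_zero
    (by rw [star_smul, star_sub, star_star, ← neg_sub x, smul_neg, ← neg_smul]; simp)
    (by rw [map_smul, map_sub, hx, hx', sub_zero, smul_zero])
  have h3 : x - star x = 0 := (smul_eq_zero.mp h2).resolve_left Complex.I_ne_zero
  have h4 : (2 : ℂ) • x = 0 := by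
    rw [two_smul, ← add_zero 0]
    nth_rewrite 1 [← h1]
    rw [← h3]
    abel
  exact (smul_eq_zero.mp h4).resolve_left two_ne_zero

/-- An operator system embeds into its universal C*-algebra. -/
theorem isCompleteOrderEmbedding_ι : IsCompleteOrderEmbedding (UniversalCStar.ι S) where
  injective := ι_injective
  mem_cone_iff {n X} := by
    refine ⟨fun h => mem_cone_of_map_ι ?_ h, UniversalCStar.isUCP_ι.map_cone⟩
    -- Hermitian symmetry of `X` is recovered from that of its image by injectivity.
    ext i j
    refine ι_injective ?_
    rw [Matrix.conjTranspose_apply, ← UniversalCStar.star_ι]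
    exact congrFun (congrFun (conjTranspose_eq h) i) j

end Embedding

/-! ### Homomorphisms out of quotient C*-algebras. -/

section QuotientHom

variable {A : Type u} [CStarAlgebra A]

open scoped CStarAlgebra in
-- The kernel of a *-homomorphism is a closed two-sided ideal.
theorem closedIdealSpan_le_ker {B : Type v} [CStarAlgebra B] {s : Set A} (π : A →⋆ₐ[ℂ] B)
    (h : ∀ x ∈ s, π x = 0) {a : A} (ha : a ∈ closedIdealSpan s) : π a = 0 := by
  have hc : Continuous π := map_continuous π
  refine closure_minimal (t := {a | π a = 0}) (fun x hx => ?_)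
    (isClosed_eq hc continuous_const) ha
  refine TwoSidedIdeal.span_induction (p := fun y _ => π y = 0) h (map_zero π)
    (fun a b _ _ ha hb => ?_) (fun a _ ha => ?_) (fun a b _ hb => ?_) (fun a b _ hb => ?_) hx
  · rw [map_add, ha, hb, add_zero]
  · rw [map_neg, ha, neg_zero]
  · rw [map_mul, hb, mul_zero]
  · rw [map_mul, hb, zero_mul]

/-- The homomorphism on a quotient C*-algebra induced by a homomorphism vanishing on the ideal. -/
noncomputable def CStarQuotient.lift (I : Ideal A) [IsCStarIdeal I] {B : Type v} [CStarAlgebra B]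
    (π : A →⋆ₐ[ℂ] B) (h : ∀ a ∈ I, π a = 0) : CStarQuotient I →⋆ₐ[ℂ] B where
  __ := Ideal.Quotient.liftₐ I (π : A →ₐ[ℂ] B) h
  map_star' := by
    rintro ⟨a⟩
    exact map_star π a

theorem CStarQuotient.hom_ext (I : Ideal A) [IsCStarIdeal I] {B : Type v} [CStarAlgebra B]
    {f g : CStarQuotient I →⋆ₐ[ℂ] B}
    (h : f.comp (CStarQuotient.mk I) = g.comp (CStarQuotient.mk I)) : f = g := by
  ext x
  obtain ⟨a, rfl⟩ := CStarQuotient.mk_surjective I x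
  exact DFunLike.congr_fun h a

end QuotientHom

/-! ### Comparison of `C*_u(S)/⟨J⟩` with `C*_u(S/J)`. -/

section Main

variable {S : Type u} [AddCommGroup S] [Module ℂ S] [StarAddMonoid S] [StarModule ℂ S]
  [OperatorSystem S] (J : Submodule ℂ S) (hJ : IsKernel J)

theorem QuotientSystem.isUCP_mk : IsUCP (QuotientSystem.mk J hJ) where
  map_unit := rfl
  map_cone hX _ hε := ⟨_, rfl, add_mem (smul_unit_mem _ hε.le) hX⟩

/-- For each `ε` a positive class has a representative `x` with `ε e + x` positive. All
representatives have the same image modulo `⟨J⟩`, so the Archimedean property of the quotient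
C*-algebra removes `ε`. -/
theorem isUCP_inducedMap : IsUCP (inducedMap J hJ) where
  map_unit := (congrArg (CStarQuotient.mk (idealGen J hJ)) UniversalCStar.ι_unit).trans
    (map_one (CStarQuotient.mk (idealGen J hJ)))
  map_cone {n X} hX := by
    have hq := (isUCP_starAlgHom (CStarQuotient.mk (idealGen J hJ))).comp
      (UniversalCStar.isUCP_ι (S := S))
    refine archimedean fun ε hε => ?_
    obtain ⟨x, rfl, hx⟩ := hX ε hε
    have h := hq.map_cone hx
    rw [Matrix.map_add _ (map_add _), map_smul_unit, hq.map_unit] at h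
    exact h

/-- The homomorphism `C*_u(S) / ⟨J⟩ → C*_u(S / J)` induced by the quotient map. -/
noncomputable def quotientToUniversal :
    CStarQuotient (idealGen J hJ) →⋆ₐ[ℂ] UniversalCStar (QuotientSystem J hJ) :=
  CStarQuotient.lift _ (UniversalCStar.lift _
    (UniversalCStar.isUCP_ι.comp (QuotientSystem.isUCP_mk J hJ))) fun _ ha =>
      closedIdealSpan_le_ker _ (by
        rintro _ ⟨x, hx, rfl⟩
        rw [UniversalCStar.lift_ι, LinearMap.comp_apply,
          (QuotientSystem.mk_eq_zero J hJ).mpr hx, map_zero]) ha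

theorem quotientToUniversal_mk_ι (x : S) :
    quotientToUniversal J hJ (CStarQuotient.mk _ (UniversalCStar.ι S x)) =
      UniversalCStar.ι _ (QuotientSystem.mk J hJ x) :=
  UniversalCStar.lift_ι _ (UniversalCStar.isUCP_ι.comp (QuotientSystem.isUCP_mk J hJ)) x

theorem quotientToUniversal_inducedMap (t : QuotientSystem J hJ) :
    quotientToUniversal J hJ (inducedMap J hJ t) = UniversalCStar.ι _ t := by
  obtain ⟨x, rfl⟩ := QuotientSystem.mk_surjective J hJ t
  exact quotientToUniversal_mk_ι J hJ x

/-- Followed by the *-homomorphism `quotientToUniversal`, this map becomes the canonical embedding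
of `S/J`. Injectivity and reflection of positivity pass to the first factor because the second
preserves positivity. -/
theorem isCompleteOrderEmbedding_inducedMap : IsCompleteOrderEmbedding (inducedMap J hJ) where
  injective s t h := ι_injective <| by
    rw [← quotientToUniversal_inducedMap, h, quotientToUniversal_inducedMap]
  mem_cone_iff {n X} := by
    refine ⟨fun h => isCompleteOrderEmbedding_ι.mem_cone_iff.mp ?_,
      (isUCP_inducedMap J hJ).map_cone⟩
    have h1 : (X.map (inducedMap J hJ)).map (quotientToUniversal J hJ) =
        X.map (UniversalCStar.ι _) := by
      ext i j
      exact quotientToUniversal_inducedMap J hJ (X i j)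
    exact h1 ▸ map_mem_matrixPos (quotientToUniversal J hJ) h

/-- The homomorphism `C*_u(S / J) → C*_u(S) / ⟨J⟩` induced by the map of `S / J`. -/
noncomputable def universalToQuotient :
    UniversalCStar (QuotientSystem J hJ) →⋆ₐ[ℂ] CStarQuotient (idealGen J hJ) :=
  UniversalCStar.lift _ (isUCP_inducedMap J hJ)

theorem universalToQuotient_ι (x : S) :
    universalToQuotient J hJ (UniversalCStar.ι _ (QuotientSystem.mk J hJ x)) =
      CStarQuotient.mk _ (UniversalCStar.ι S x) :=
  UniversalCStar.lift_ι _ _ _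

theorem quotientToUniversal_comp :
    (quotientToUniversal J hJ).comp (universalToQuotient J hJ) = StarAlgHom.id ℂ _ := by
  refine UniversalCStar.hom_ext fun t => ?_
  obtain ⟨x, rfl⟩ := QuotientSystem.mk_surjective J hJ t
  rw [StarAlgHom.comp_apply, universalToQuotient_ι, quotientToUniversal_mk_ι]
  rfl

theorem universalToQuotient_comp :
    (universalToQuotient J hJ).comp (quotientToUniversal J hJ) = StarAlgHom.id ℂ _ := by
  refine CStarQuotient.hom_ext _ (UniversalCStar.hom_ext fun x => ?_)
  simp only [StarAlgHom.comp_apply]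
  rw [quotientToUniversal_mk_ι, universalToQuotient_ι]
  rfl

end Main

end OperatorSystem

theorem mainTheorem10 {S : Type u} [AddCommGroup S] [Module ℂ S] [StarAddMonoid S]
    [StarModule ℂ S] [OperatorSystem S] (J : Submodule ℂ S) (hJ : OperatorSystem.IsKernel J) :
    (∀ x : S, OperatorSystem.UniversalCStar.ι S x ∈ OperatorSystem.idealGen J hJ ↔ x ∈ J) ∧
    OperatorSystem.IsCompleteOrderEmbedding (OperatorSystem.inducedMap J hJ) ∧
    ∃ π : OperatorSystem.UniversalCStar (OperatorSystem.QuotientSystem J hJ) ≃⋆ₐ[ℂ]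
        OperatorSystem.CStarQuotient (OperatorSystem.idealGen J hJ),
      ∀ x : S,
        π (OperatorSystem.UniversalCStar.ι _ (OperatorSystem.QuotientSystem.mk J hJ x)) =
          OperatorSystem.CStarQuotient.mk _ (OperatorSystem.UniversalCStar.ι S x) := by
  have hemb := OperatorSystem.isCompleteOrderEmbedding_inducedMap J hJ
  refine ⟨fun x => ?_, hemb, StarAlgEquiv.ofStarAlgHom
    (OperatorSystem.universalToQuotient J hJ) (OperatorSystem.quotientToUniversal J hJ)
    (OperatorSystem.quotientToUniversal_comp J hJ) (OperatorSystem.universalToQuotient_comp J hJ),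
    OperatorSystem.universalToQuotient_ι J hJ⟩
  -- Membership in `⟨J⟩` says that the induced map kills `x + J`, so the first assertion is its
  -- injectivity.
  rw [← OperatorSystem.CStarQuotient.mk_eq_zero, ← OperatorSystem.QuotientSystem.mk_eq_zero J hJ,
    ← OperatorSystem.inducedMap_mk, map_eq_zero_iff _ hemb.injective]
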